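/- Let $d_1,d_2,n_0\ge 1$ be integers, $d\ge\max(d_1,d_2)$ a real number (for instance $d=\max(d_1,d_2)$ or $d=d_1+d_2$), $\delta\in(0,1)$, $\sigma\ge 0$. Let $\pi$ be a probability distribution supported on a set $\mathcal A\subset\mathbb R^{d_1\times d_2}$ whose entries have finite second moments under $\pi$ (automatic if $\mathcal A$ is bounded), such that $Q:=\mathbb E_{A\sim\pi}[\mathrm{vec}(A)\mathrm{vec}(A)^\top]$ is invertible; here $\mathrm{vec}$ stacks columns and $\mathrm{reshape}$ is its inverse. Index $Q^{-1}$ by pairs $(i,k)$, $1\le i\le d_2$, $1\le k\le d_1$ (column, row), and set $$D_i^{(\mathrm{col})}=\big[(Q^{-1})_{(i,k),(i,l)}\big]_{k,l\le d_1},\qquad D_k^{(\mathrm{row})}=\big[(Q^{-1})_{(i,k),(j,k)}\big]_{i,j\le d_2},$$ $$B(Q)=\max\Big(\lambda_{\max}\Big(\sum_{i=1}^{d_2}D_i^{(\mathrm{col})}\Big),\ \lambda_{\max}\Big(\sum_{k=1}^{d_1}D_k^{(\mathrm{row})}\Big)\Big).$$ Let $\Theta^*\in\mathbb R^{d_1\times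 d_2}$ have rank $r$, let $\Theta_0\in\mathbb R^{d_1\times d_2}$ be a (fixed) pilot estimate, and let $R_0$ satisfy $|\langle\Theta_0-\Theta^*,A\rangle|\le R_0$ for all $A\in\mathcal A$, with $\sigma^2+R_0^2>0$. Observe $(X_i,Y_i)$, $Y_i=\langle\Theta^*,X_i\rangle+\eta_i$, $i=1,\dots,n_0$, where the pairs $(X_i,\eta_i)$ are independent, $X_i\sim\pi$, $\eta_i$ is square integrable, $\mathbb E[\eta_i\mid X_i]=0$ and $\mathbb E[\eta_i^2\mid X_i]\le\sigma^2$ almost surely (in particular, independent zero-mean $\sigma$-subgaussian noise is allowed). Put $\varphi(x)=\ln(1+x+x^2/2)$ for $x\ge0$ and $\varphi(x)=-\ln(1-x+x^2/2)$ for $x<0$, applied to symmetric matrices through their eigenvalues, $\mathcal H(M)=\begin{pmatrix}0&M\\M^\top&0\end{pmatrix}$, $M_i=\mathrm{reshape}\big((Y_i-\langle\Theta_0,X_i\rangle)\,Q^{-1}\mathrm{vec}(X_i)\big)$, $$\nu=\sqrt{\frac{\ln(2d/\delta)}{(\sigma^2+R_0^2)B(Q)n_0}},\qquad \Theta_1=\Theta_0+\frac1{n_0\nu}\Big(\sum_{i=1}^{n_0}\varphi(\nu\mathcal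 H(M_i))\Big)_{\mathsf{ht}},$$ where $(\cdot)_{\mathsf{ht}}$ is the upper right $d_1\times d_2$ block. Let $$\tau=2\sqrt{\frac{(\sigma^2+R_0^2)\,B(Q)\,\ln(2d/\delta)}{n_0}},$$ and let $\hat\Theta$ be obtained from a singular value decomposition of $\Theta_1$ by replacing all singular values that are at most $\tau$ by $0$. Then, with probability at least $1-\delta$, simultaneously $$\mathrm{rank}(\hat\Theta)\le r\qquad\text{and}\qquad\|\hat\Theta-\Theta^*\|_{\mathrm{op}}\le 2\tau .$$ -/

import Mathlib

open MeasureTheory ProbabilityTheory Matrix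

/-- Real matrices carry the product (Borel) σ-algebra. -/
instance matrixMeasurableSpace {m n : Type*} : MeasurableSpace (Matrix m n ℝ) :=
  MeasurableSpace.pi

noncomputable section

namespace LowPopArt

/-- The trace inner product `⟨A, B⟩ = tr (Aᵀ B)`. -/
def ip {d₁ d₂ : ℕ} (A B : Matrix (Fin d₁) (Fin d₂) ℝ) : ℝ := (Aᵀ * B).trace

/-- The operator norm of a matrix (with respect to the Euclidean norms). -/
def opNorm {d₁ d₂ : ℕ} (A : Matrix (Fin d₁) (Fin d₂) ℝ) : ℝ :=
  ‖LinearMap.toContinuousLinearMap (Matrix.toEuclideanLin A)‖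

/-- The largest eigenvalue (used for symmetric matrices). -/
def lambdaMax {n : ℕ} (A : Matrix (Fin n) (Fin n) ℝ) : ℝ := sSup (spectrum ℝ A)

/-- `Q(π) = 𝔼_{A ∼ π} [vec(A) vec(A)ᵀ]`. The entry of the column-stacking `vec A` at the
index `(i, k)` is `A k i`: `i` is the column (the block), `k` the row (the position in it). -/
def covMatrix {d₁ d₂ : ℕ} (π : Measure (Matrix (Fin d₁) (Fin d₂) ℝ)) :
    Matrix (Fin d₂ × Fin d₁) (Fin d₂ × Fin d₁) ℝ :=
  Matrix.of fun p q => ∫ A, vec A p * vec A q ∂π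

/-- `D_i^(col)`: the `i`-th diagonal block, of size `d₁ × d₁`, of `Q⁻¹`. -/
def colBlock {d₁ d₂ : ℕ} (Q : Matrix (Fin d₂ × Fin d₁) (Fin d₂ × Fin d₁) ℝ) (i : Fin d₂) :
    Matrix (Fin d₁) (Fin d₁) ℝ :=
  Matrix.of fun k l => Q⁻¹ (i, k) (i, l)

/-- `D_k^(row)`: the `d₂ × d₂` submatrix of `Q⁻¹` that collects the `k`-th entries of the blocks. -/
def rowBlock {d₁ d₂ : ℕ} (Q : Matrix (Fin d₂ × Fin d₁) (Fin d₂ × Fin d₁) ℝ) (k : Fin d₁) :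
    Matrix (Fin d₂) (Fin d₂) ℝ :=
  Matrix.of fun i j => Q⁻¹ (i, k) (j, k)

/-- `B(Q) = max (λ_max (∑ᵢ D_i^(col)), λ_max (∑ₖ D_k^(row)))`. -/
def B {d₁ d₂ : ℕ} (Q : Matrix (Fin d₂ × Fin d₁) (Fin d₂ × Fin d₁) ℝ) : ℝ :=
  max (lambdaMax (∑ i, colBlock Q i)) (lambdaMax (∑ k, rowBlock Q k))

/-- Catoni's influence function. -/
def catoni (x : ℝ) : ℝ :=
  if 0 ≤ x then Real.log (1 + x + x ^ 2 / 2) else -Real.log (1 - x + x ^ 2 / 2)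

/-- The symmetric (Hermitian) dilation `[[0, A], [Aᵀ, 0]]`. -/
def dilation {d₁ d₂ : ℕ} (A : Matrix (Fin d₁) (Fin d₂) ℝ) :
    Matrix (Fin d₁ ⊕ Fin d₂) (Fin d₁ ⊕ Fin d₂) ℝ :=
  Matrix.fromBlocks 0 A Aᵀ 0

/-- The one-sample estimate `reshape ((y - ⟨Θ₀, x⟩) Q⁻¹ vec(x))` of `Θ* - Θ₀`. -/
def oneSample {d₁ d₂ : ℕ} (Q : Matrix (Fin d₂ × Fin d₁) (Fin d₂ × Fin d₁) ℝ)
    (Θ₀ x : Matrix (Fin d₁) (Fin d₂) ℝ) (y : ℝ) : Matrix (Fin d₁) (Fin d₂) ℝ :=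
  Matrix.of fun k i => (y - ip Θ₀ x) * (Q⁻¹ *ᵥ vec x) (i, k)

/-- The scale `ν = √(ln(2d/δ) / ((σ² + R₀²) B(Q) n₀))` of the robust matrix mean estimator. -/
def scale {d₁ d₂ : ℕ} (Q : Matrix (Fin d₂ × Fin d₁) (Fin d₂ × Fin d₁) ℝ)
    (d σ R₀ δ : ℝ) (n₀ : ℕ) : ℝ :=
  Real.sqrt (Real.log (2 * d / δ) / ((σ ^ 2 + R₀ ^ 2) * B Q * n₀))

/-- The threshold `τ = 2 √((σ² + R₀²) B(Q) ln(2d/δ) / n₀)`. -/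
def threshold {d₁ d₂ : ℕ} (Q : Matrix (Fin d₂ × Fin d₁) (Fin d₂ × Fin d₁) ℝ)
    (d σ R₀ δ : ℝ) (n₀ : ℕ) : ℝ :=
  2 * Real.sqrt ((σ ^ 2 + R₀ ^ 2) * B Q * Real.log (2 * d / δ) / n₀)

/-- The estimator before thresholding,
`Θ₁ = Θ₀ + (1 / (n₀ ν)) (∑ᵢ φ(ν H(Mᵢ)))_ht`, where `φ` is Catoni's function, applied to
symmetric matrices by functional calculus, `H` is the dilation, `Mᵢ` is the `i`-th one-sample
estimate, and `_ht` takes the upper right `d₁ × d₂` block. -/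
def firstEstimate {d₁ d₂ n₀ : ℕ} (Q : Matrix (Fin d₂ × Fin d₁) (Fin d₂ × Fin d₁) ℝ)
    (Θ₀ : Matrix (Fin d₁) (Fin d₂) ℝ) (ν : ℝ)
    (x : Fin n₀ → Matrix (Fin d₁) (Fin d₂) ℝ) (y : Fin n₀ → ℝ) :
    Matrix (Fin d₁) (Fin d₂) ℝ :=
  Θ₀ + (1 / (n₀ * ν)) •
    (∑ i, cfc catoni (ν • dilation (oneSample Q Θ₀ (x i) (y i)))).toBlocks₁₂

/-- Hard thresholding of the singular values: the singular values `> τ` are kept, the others are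
set to zero. The functional calculus gives the orthogonal projection onto the span of the right
singular vectors whose singular value exceeds `τ`; `hardThreshold_eq_of_svd` expresses the result
through an arbitrary singular value decomposition. -/
def hardThreshold {d₁ d₂ : ℕ} (τ : ℝ) (M : Matrix (Fin d₁) (Fin d₂) ℝ) :
    Matrix (Fin d₁) (Fin d₂) ℝ :=
  M * cfc (fun x : ℝ => if τ < Real.sqrt x then (1 : ℝ) else 0) (Mᵀ * M)

/-- If `M = U diag(s) Vᵀ` is a singular value decomposition, then thresholding replaces `s k` by
`0` whenever `s k ≤ τ`. -/
theorem hardThreshold_eq_of_svd {d₁ d₂ : ℕ} {κ : Type*} [Fintype κ] [DecidableEq κ] (τ : ℝ)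
    (M : Matrix (Fin d₁) (Fin d₂) ℝ) (U : Matrix (Fin d₁) κ ℝ) (V : Matrix (Fin d₂) κ ℝ)
    (s : κ → ℝ) (hs : ∀ k, 0 ≤ s k) (hU : Uᵀ * U = 1) (hV : Vᵀ * V = 1)
    (hM : M = U * Matrix.diagonal s * Vᵀ) :
    hardThreshold τ M =
      U * Matrix.diagonal (fun k => if τ < s k then s k else 0) * Vᵀ := by
  classical
  set f : ℝ → ℝ := fun x => if τ < Real.sqrt x then (1 : ℝ) else 0 with hf
  have hA : IsSelfAdjoint (Mᵀ * M) := by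
    rw [isSelfAdjoint_iff, star_eq_conjTranspose, conjTranspose_eq_transpose_of_trivial,
      transpose_mul, transpose_transpose]
  have hfin : (spectrum ℝ (Mᵀ * M)).Finite := Matrix.finite_real_spectrum
  set T : Finset ℝ := hfin.toFinset ∪ Finset.univ.image (fun k => s k ^ 2) with hT
  set p : Polynomial ℝ := Lagrange.interpolate T id f with hp
  have hpe : ∀ x ∈ T, p.eval x = f x := fun x hx =>
    Lagrange.eval_interpolate_at_node (v := id) f (Set.injOn_id _) hx
  have h1 : cfc f (Mᵀ * M) = Polynomial.aeval (Mᵀ * M) p := by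
    rw [← cfc_polynomial p (Mᵀ * M) hA]
    exact cfc_congr fun x hx => (hpe x (by simp [hT, hx])).symm
  have hMM : Mᵀ * M = V * Matrix.diagonal (fun k => s k ^ 2) * Vᵀ := by
    rw [hM]
    simp only [transpose_mul, transpose_transpose, diagonal_transpose, Matrix.mul_assoc]
    rw [← Matrix.mul_assoc Uᵀ, hU, Matrix.one_mul, ← Matrix.mul_assoc (diagonal s) (diagonal s),
      diagonal_mul_diagonal]
    simp only [pow_two]
  have h2 : ∀ q : Polynomial ℝ, M * Polynomial.aeval (Mᵀ * M) q =
      U * Matrix.diagonal (fun k => s k * q.eval (s k ^ 2)) * Vᵀ := by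
    have hpow : ∀ n : ℕ, M * (Mᵀ * M) ^ n =
        U * Matrix.diagonal (fun k => s k * (s k ^ 2) ^ n) * Vᵀ := by
      intro n
      induction n with
      | zero => simp [hM]
      | succ n ih =>
        rw [pow_succ, ← Matrix.mul_assoc, ih, hMM]
        simp only [Matrix.mul_assoc]
        rw [← Matrix.mul_assoc Vᵀ, hV, Matrix.one_mul, ← Matrix.mul_assoc (diagonal _) (diagonal _),
          diagonal_mul_diagonal]
        simp only [pow_succ, mul_assoc]
    intro q
    induction q using Polynomial.induction_on' with
    | add a b ha hb =>
      rw [map_add, Matrix.mul_add, ha, hb, ← Matrix.add_mul, ← Matrix.mul_add, diagonal_add]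
      simp only [Polynomial.eval_add, mul_add]
    | monomial n a =>
      rw [Polynomial.aeval_monomial, ← Algebra.smul_def, Matrix.mul_smul, hpow, ← Matrix.smul_mul,
        ← Matrix.mul_smul, ← diagonal_smul]
      congr 3
      funext k
      simp only [Pi.smul_apply, smul_eq_mul, Polynomial.eval_monomial]
      ring
  rw [hardThreshold, h1, h2]
  congr 3
  funext k
  rw [hpe _ (by simp [hT])]
  simp [hf, Real.sqrt_sq (hs k)]

/-- The LowPopArt estimator: `Θ₁` with its singular values hard-thresholded at the level `τ`. -/
def lowPopArt {d₁ d₂ n₀ : ℕ} (Q : Matrix (Fin d₂ × Fin d₁) (Fin d₂ × Fin d₁) ℝ)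
    (Θ₀ : Matrix (Fin d₁) (Fin d₂) ℝ) (d σ R₀ δ : ℝ)
    (x : Fin n₀ → Matrix (Fin d₁) (Fin d₂) ℝ) (y : Fin n₀ → ℝ) :
    Matrix (Fin d₁) (Fin d₂) ℝ :=
  hardThreshold (threshold Q d σ R₀ δ n₀)
    (firstEstimate Q Θ₀ (scale Q d σ R₀ δ n₀) x y)

end LowPopArt

end

/-!
The estimator before thresholding is within `τ` of `Θ` in operator norm with probability at least
`1 - δ`; the rest is deterministic.

*Deterministic part.* If `‖Θ₁ - Θ‖ ≤ τ`, a nonzero vector in the span of the right singular vectors of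
`Θ₁` with singular value `> τ` that is annihilated by `Θ` would be expanded by `Θ₁ - Θ` by more than `τ`.
So there are at most `rank Θ` such singular vectors (`rank_hardThreshold_le`). Thresholding moves
`Θ₁` by at most `τ`, which gives the bound `2 τ` (`opNorm_hardThreshold_sub_le_two_mul`).

*Probabilistic part.* Let `Zᵢ = ν H(Mᵢ)` be the scaled dilation of the `i`-th one-sample estimate.
Its mean is `S = ν H(Θ - Θ₀)`, and its second moment is at most `ν² v` with
`v = (σ² + R₀²) B(Q)` (`moments_dilation`): the blocks of `Zᵢ²` are sums of squares of linear
functionals of `Mᵢ`, the covariance of `Q⁻¹ vec(X)` is `Q⁻¹`, and conditionally on `X` the squared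
residual has mean at most `σ² + R₀²`. Catoni's function satisfies `φ(x) ≤ log (1 + x + x² / 2)`.
Since `A ↦ tr exp (H + log A)` is concave (Lieb), Jensen's inequality gives, for every symmetric `H`,
`𝔼 tr exp (H + φ(Zᵢ)) ≤ tr exp (H + log (1 + S + 𝔼 Zᵢ² / 2)) ≤ tr exp (H + S + ν² v / 2)`
(`lintegral_trace_exp_catoni_le`). By independence this can be iterated
(`lintegral_trace_exp_sum_le`), and with `H = - n₀ S` the trace exponential of
`G = ∑ φ(Zᵢ) - n₀ S` has mean at most `(d₁ + d₂) exp (n₀ ν² v / 2)`. Markov's inequality bounds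
the largest eigenvalue of `G`. As `φ` is odd, the diagonal blocks of `G` vanish, hence a one-sided
bound on the spectrum already controls the norm of the off-diagonal block, which is
`n₀ ν (Θ₁ - Θ)` (`opNorm_toBlocks₁₂_le`, `measure_lt_opNorm_firstEstimate_sub_le`).

*Lieb's theorem.* By the Gibbs variational principle `tr exp K` is the maximum over `T > 0` of
`tr (T K) + tr T - tr (T log T)`, so `tr exp (H + log A)` is a partial maximum over `T` of
`tr (T H) + tr A - D(T, A)` with the relative entropy `D`; its concavity in `A` follows from the
joint convexity of `D`. For the latter, Taylor's formula for `x log x` writes `D(T, A)` as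
`∫₀¹ (1 - s) ∑ (aᵢ - bⱼ)² / (s aᵢ + (1 - s) bⱼ) cᵢⱼ² ds` in terms of the eigenvalues and the overlaps
`cᵢⱼ` of the eigenvectors of `T` and `A`. For each `s` the sum is the supremum over matrices `W` of
`2 tr (Wᵀ (T - A)) - s tr (Wᵀ T W) - (1 - s) tr (Wᵀ W A)`, which is linear in `(T, A)`
(`relEntropy_eq_integral`).
-/

noncomputable section

namespace LowPopArt

/-! ### Functional calculus of real symmetric matrices -/

section Spectral

variable {n : Type*} [Fintype n] [DecidableEq n]

/-- The spectral theorem in the form used throughout: one orthogonal matrix diagonalizes every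
function of a symmetric matrix. -/
lemma exists_diagonalization {A : Matrix n n ℝ} (hA : A.IsHermitian) :
    ∃ (U : Matrix n n ℝ) (a : n → ℝ), Uᵀ * U = 1 ∧ U * Uᵀ = 1 ∧ (∀ i, a i ∈ spectrum ℝ A) ∧
      A = U * diagonal a * Uᵀ ∧
      ∀ f : ℝ → ℝ, cfc f A = U * diagonal (fun i => f (a i)) * Uᵀ := by
  have h : ∀ f : ℝ → ℝ, cfc f A = (hA.eigenvectorUnitary : Matrix n n ℝ) *
      diagonal (fun i => f (hA.eigenvalues i)) * (hA.eigenvectorUnitary : Matrix n n ℝ)ᵀ := by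
    intro f
    rw [hA.cfc_eq, IsHermitian.cfc, Unitary.conjStarAlgAut_apply]
    simp [star_eq_conjTranspose, conjTranspose_eq_transpose_of_trivial, Function.comp_def]
  refine ⟨hA.eigenvectorUnitary, hA.eigenvalues, ?_, ?_, hA.eigenvalues_mem_spectrum_real, ?_, h⟩
  · simpa [star_eq_conjTranspose, conjTranspose_eq_transpose_of_trivial] using
      Unitary.coe_star_mul_self hA.eigenvectorUnitary
  · simpa [star_eq_conjTranspose, conjTranspose_eq_transpose_of_trivial] using
      Unitary.coe_mul_star_self hA.eigenvectorUnitary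
  · have := h id
    rwa [cfc_id ℝ A hA.isSelfAdjoint] at this

lemma isHermitian_cfc (f : ℝ → ℝ) (A : Matrix n n ℝ) : (cfc f A).IsHermitian :=
  cfc_predicate f A

lemma spectrum_pos_of_posDef {A : Matrix n n ℝ} (hA : A.PosDef) {x : ℝ}
    (hx : x ∈ spectrum ℝ A) : 0 < x := by
  rw [hA.isHermitian.spectrum_real_eq_range_eigenvalues] at hx
  obtain ⟨i, rfl⟩ := hx
  exact hA.eigenvalues_pos i

lemma trace_diagonalized_mul (U V : Matrix n n ℝ) (a b : n → ℝ) :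
    ((U * diagonal a * Uᵀ) * (V * diagonal b * Vᵀ)).trace =
      ∑ i, ∑ j, a i * b j * (Uᵀ * V) i j ^ 2 := by
  have h : ((U * diagonal a * Uᵀ) * (V * diagonal b * Vᵀ)).trace =
      ((diagonal a * (Uᵀ * V)) * (diagonal b * (Uᵀ * V)ᵀ)).trace := by
    rw [transpose_mul, transpose_transpose]
    simp only [Matrix.mul_assoc]
    rw [Matrix.trace_mul_comm U]
    simp only [Matrix.mul_assoc]
  rw [h, trace]
  refine Finset.sum_congr rfl fun i _ => ?_
  rw [diag_apply, Matrix.mul_apply]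
  refine Finset.sum_congr rfl fun j _ => ?_
  rw [diagonal_mul, diagonal_mul, transpose_apply]
  ring

/-- A scalar inequality between functions of two variables passes to traces of products of
functions of two (not necessarily commuting) symmetric matrices. -/
lemma sum_trace_cfc_mul_cfc_nonneg {κ : Type*} (s : Finset κ) {A B : Matrix n n ℝ}
    (hA : A.IsHermitian) (hB : B.IsHermitian) (f g : κ → ℝ → ℝ)
    (h : ∀ x ∈ spectrum ℝ A, ∀ y ∈ spectrum ℝ B, 0 ≤ ∑ k ∈ s, f k x * g k y) :
    0 ≤ ∑ k ∈ s, (cfc (f k) A * cfc (g k) B).trace := by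
  obtain ⟨U, a, -, -, ha, -, hU⟩ := exists_diagonalization hA
  obtain ⟨V, b, -, -, hb, -, hV⟩ := exists_diagonalization hB
  simp only [hU, hV, trace_diagonalized_mul]
  rw [Finset.sum_comm]
  refine Finset.sum_nonneg fun i _ => ?_
  rw [Finset.sum_comm]
  refine Finset.sum_nonneg fun j _ => ?_
  rw [← Finset.sum_mul]
  exact mul_nonneg (h _ (ha i) _ (hb j)) (sq_nonneg _)

/-- The Gibbs variational inequality for the trace exponential. -/
lemma gibbs_le_trace_exp {T K : Matrix n n ℝ} (hT : T.PosDef) (hK : K.IsHermitian) :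
    (T * K).trace + T.trace - (T * cfc Real.log T).trace ≤ (cfc Real.exp K).trace := by
  have hT' : IsSelfAdjoint T := hT.isHermitian
  have hK' : IsSelfAdjoint K := hK
  have h := sum_trace_cfc_mul_cfc_nonneg Finset.univ hT.isHermitian hK
    ![fun _ => 1, fun x => -x, fun x => -x, fun x => x * Real.log x]
    ![Real.exp, fun y => y, fun _ => 1, fun _ => 1] ?_
  · have h1 : cfc (fun x => x * Real.log x) T = T * cfc Real.log T := by
      rw [cfc_mul (fun x : ℝ => x) Real.log T (by fun_prop)
        (Matrix.finite_real_spectrum.continuousOn _), cfc_id' ℝ T]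
    have h2 : cfc (fun x : ℝ => -x) T = -T := cfc_neg_id (R := ℝ) (a := T)
    simp [Fin.sum_univ_four, h1, h2, cfc_id' ℝ K, cfc_const_one ℝ T, cfc_const_one ℝ K] at h
    linarith
  · intro x hx y _
    have hx0 := spectrum_pos_of_posDef hT hx
    simp only [Fin.sum_univ_four, Matrix.cons_val]
    have := Real.add_one_le_exp (y - Real.log x)
    rw [Real.exp_sub, Real.exp_log hx0, le_div_iff₀ hx0] at this
    nlinarith

lemma posDef_cfc_exp (K : Matrix n n ℝ) (hK : K.IsHermitian) : (cfc Real.exp K).PosDef := by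
  obtain ⟨U, a, hU1, hU2, -, -, hU⟩ := exists_diagonalization hK
  rw [hU]
  have h : (diagonal (fun i => Real.exp (a i))).PosDef :=
    PosDef.diagonal fun i => Real.exp_pos _
  have hinj : Function.Injective Uᵀ.mulVec := fun x y hxy => by
    simpa [Matrix.mulVec_mulVec, hU2] using congrArg (U *ᵥ ·) hxy
  have := h.conjTranspose_mul_mul_same hinj
  simpa [conjTranspose_eq_transpose_of_trivial] using this

lemma cfc_log_cfc_exp {K : Matrix n n ℝ} (hK : K.IsHermitian) :
    cfc Real.log (cfc Real.exp K) = K := by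
  have hK' : IsSelfAdjoint K := hK
  rw [← cfc_comp Real.log Real.exp K hK'
    ((Matrix.finite_real_spectrum.image _).continuousOn _)]
  simp [Function.comp_def, cfc_id' ℝ K]

lemma trace_mul_nonneg {A B : Matrix n n ℝ} (hA : A.PosSemidef) (hB : B.PosSemidef) :
    0 ≤ (A * B).trace := by
  have hA' : IsSelfAdjoint A := hA.isHermitian
  have hB' : IsSelfAdjoint B := hB.isHermitian
  have h := sum_trace_cfc_mul_cfc_nonneg {()} hA.isHermitian hB.isHermitian
    (fun _ x => x) (fun _ y => y) ?_
  · simpa [cfc_id' ℝ A, cfc_id' ℝ B] using h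
  · intro x hx y hy
    rw [hA.isHermitian.spectrum_real_eq_range_eigenvalues] at hx
    rw [hB.isHermitian.spectrum_real_eq_range_eigenvalues] at hy
    obtain ⟨i, rfl⟩ := hx
    obtain ⟨j, rfl⟩ := hy
    simpa using mul_nonneg (hA.eigenvalues_nonneg i) (hB.eigenvalues_nonneg j)

/-- The trace exponential is monotone for the Loewner order. -/
lemma trace_exp_le_trace_exp {K L : Matrix n n ℝ} (hK : K.IsHermitian) (hL : L.IsHermitian)
    (h : (L - K).PosSemidef) : (cfc Real.exp K).trace ≤ (cfc Real.exp L).trace := by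
  have h1 := gibbs_le_trace_exp (posDef_cfc_exp K hK) hL
  rw [cfc_log_cfc_exp hK] at h1
  have h2 : 0 ≤ (cfc Real.exp K * (L - K)).trace :=
    trace_mul_nonneg (posDef_cfc_exp K hK).posSemidef h
  rw [Matrix.mul_sub, trace_sub] at h2
  linarith

end Spectral

/-! ### Joint convexity of the relative entropy and Lieb's concavity theorem -/

/-- A functional that is affine in the pair `(T, A)`; the supremum over `W` of these functionals
is the second-order divergence that integrates to the relative entropy. -/
def divergenceForm {n : Type*} [Fintype n] (s : ℝ) (W T A : Matrix n n ℝ) : ℝ :=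
  2 * (Wᵀ * (T - A)).trace - (s * (Wᵀ * T * W).trace + (1 - s) * (Wᵀ * W * A).trace)

lemma divergenceForm_combo {n : Type*} [Fintype n] (s : ℝ) (W T₁ T₂ A₁ A₂ : Matrix n n ℝ) (p q : ℝ) :
    divergenceForm s W (p • T₁ + q • T₂) (p • A₁ + q • A₂) =
      p * divergenceForm s W T₁ A₁ + q * divergenceForm s W T₂ A₂ := by
  simp only [divergenceForm, Matrix.mul_add, Matrix.add_mul, Matrix.mul_sub, trace_add, trace_sub,
    Matrix.mul_smul, Matrix.smul_mul, trace_smul, smul_eq_mul]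
  ring

section Lieb

variable {n : Type*} [Fintype n] [DecidableEq n]

/-- The (generalized) relative entropy `tr (T log T - T log A - T + A)`. -/
def relEntropy (T A : Matrix n n ℝ) : ℝ :=
  (T * cfc Real.log T).trace - (T * cfc Real.log A).trace - T.trace + A.trace

lemma interp_pos {a b s : ℝ} (ha : 0 < a) (hb : 0 < b) (h0 : 0 ≤ s) (h1 : s ≤ 1) :
    0 < s * a + (1 - s) * b := by
  rcases h0.eq_or_lt with rfl | h
  · simpa
  · exact add_pos_of_pos_of_nonneg (mul_pos h ha) (mul_nonneg (by linarith) hb.le)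

lemma continuousOn_interp {a b : ℝ} (ha : 0 < a) (hb : 0 < b) :
    ContinuousOn (fun s : ℝ => (a - b) ^ 2 / (s * a + (1 - s) * b)) (Set.Icc 0 1) :=
  ContinuousOn.div (by fun_prop) (by fun_prop) fun _ hs => (interp_pos ha hb hs.1 hs.2).ne'

/-- Taylor's formula with integral remainder for `x log x`. -/
lemma integral_interp {a b : ℝ} (ha : 0 < a) (hb : 0 < b) :
    ∫ s in (0 : ℝ)..1, (1 - s) * ((a - b) ^ 2 / (s * a + (1 - s) * b)) =
      a * Real.log a - a * Real.log b - a + b := by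
  have hderiv : ∀ s ∈ Set.uIcc (0 : ℝ) 1, HasDerivAt
      (fun s : ℝ => (1 - s) * (a - b) * (Real.log (s * a + (1 - s) * b) + 1) +
        (s * a + (1 - s) * b) * Real.log (s * a + (1 - s) * b))
      ((1 - s) * ((a - b) ^ 2 / (s * a + (1 - s) * b))) s := by
    intro s hs
    rw [Set.uIcc_of_le zero_le_one] at hs
    have hx := (interp_pos ha hb hs.1 hs.2).ne'
    have h1 : HasDerivAt (fun s : ℝ => s * a + (1 - s) * b) (1 * a + -1 * b) s :=
      ((hasDerivAt_id s).mul_const a).add (((hasDerivAt_id s).const_sub 1).mul_const b)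
    have h2 : HasDerivAt (fun s : ℝ => (1 - s) * (a - b)) (-1 * (a - b)) s :=
      ((hasDerivAt_id s).const_sub 1).mul_const _
    convert! (h2.mul ((h1.log hx).add_const 1)).add (h1.mul (h1.log hx)) using 1
    field_simp
    ring
  rw [intervalIntegral.integral_eq_sub_of_hasDerivAt hderiv]
  · norm_num
    ring
  · apply ContinuousOn.intervalIntegrable
    rw [Set.uIcc_of_le zero_le_one]
    exact ContinuousOn.mul (by fun_prop) (continuousOn_interp ha hb)

/-- The relative entropy as an integral of suprema of affine functionals of the pair `(T, A)`. In
eigenbases of `T` and `A` both sides are sums of scalar functions of pairs of eigenvalues. -/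
lemma relEntropy_eq_integral {T A : Matrix n n ℝ} (hT : T.PosDef) (hA : A.PosDef) :
    ∃ φ : ℝ → ℝ, ContinuousOn φ (Set.Icc 0 1) ∧
      relEntropy T A = ∫ s in (0 : ℝ)..1, (1 - s) * φ s ∧
      ∀ s ∈ Set.Icc (0 : ℝ) 1, IsGreatest (Set.range fun W => divergenceForm s W T A) (φ s) := by
  obtain ⟨U, a, hU1, hU2, ha, hTU, hU⟩ := exists_diagonalization hT.isHermitian
  obtain ⟨V, b, hV1, hV2, hb, hAV, hV⟩ := exists_diagonalization hA.isHermitian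
  replace ha i := spectrum_pos_of_posDef hT (ha i)
  replace hb i := spectrum_pos_of_posDef hA (hb i)
  set c : Matrix n n ℝ := Uᵀ * V with hc
  have hcc : c * cᵀ = 1 := by
    rw [hc, transpose_mul, transpose_transpose, Matrix.mul_assoc, ← Matrix.mul_assoc V, hV2,
      Matrix.one_mul, hU1]
  have hcc' : cᵀ * c = 1 := by
    rw [hc, transpose_mul, transpose_transpose, Matrix.mul_assoc, ← Matrix.mul_assoc U, hU2,
      Matrix.one_mul, hV1]
  have hrow : ∀ i, ∑ j, c i j ^ 2 = 1 := fun i => by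
    have := congrFun (congrFun hcc i) i
    simpa [Matrix.mul_apply, pow_two] using this
  have hcol : ∀ j, ∑ i, c i j ^ 2 = 1 := fun j => by
    have := congrFun (congrFun hcc' j) j
    simpa [Matrix.mul_apply, pow_two] using this
  have hI : ∀ i j, IntervalIntegrable (fun s : ℝ => (1 - s) *
      ((a i - b j) ^ 2 / (s * a i + (1 - s) * b j)) * c i j ^ 2) volume 0 1 := fun i j => by
    apply ContinuousOn.intervalIntegrable
    rw [Set.uIcc_of_le zero_le_one]
    exact (ContinuousOn.mul (by fun_prop) (continuousOn_interp (ha i) (hb j))).mul (by fun_prop)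
  refine ⟨fun s => ∑ i, ∑ j, (a i - b j) ^ 2 / (s * a i + (1 - s) * b j) * c i j ^ 2, ?_, ?_, ?_⟩
  · exact continuousOn_finsetSum _ fun i _ => continuousOn_finsetSum _ fun j _ =>
      (continuousOn_interp (ha i) (hb j)).mul continuousOn_const
  · simp only [Finset.mul_sum, ← mul_assoc]
    rw [intervalIntegral.integral_finsetSum fun i _ => by
      simpa only [Finset.sum_fn] using IntervalIntegrable.sum Finset.univ fun j _ => hI i j]
    simp only [intervalIntegral.integral_finsetSum fun j _ => hI _ j,
      intervalIntegral.integral_mul_const, integral_interp (ha _) (hb _)]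
    have e1 : (T * cfc Real.log T).trace = ∑ i, ∑ j, a i * Real.log (a i) * c i j ^ 2 := by
      have : T * cfc Real.log T = U * diagonal (fun i => a i * Real.log (a i)) * Uᵀ := by
        rw [hU, ← diagonal_mul_diagonal]
        nth_rw 1 [hTU]
        simp only [Matrix.mul_assoc]
        rw [← Matrix.mul_assoc Uᵀ U, hU1, Matrix.one_mul]
      rw [this, Matrix.trace_mul_comm, ← Matrix.mul_assoc, hU1, Matrix.one_mul, trace_diagonal]
      simp only [← Finset.mul_sum, hrow, mul_one]
    have e2 : (T * cfc Real.log A).trace = ∑ i, ∑ j, a i * Real.log (b j) * c i j ^ 2 := by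
      nth_rw 1 [hV, hTU]
      exact trace_diagonalized_mul U V _ _
    have e3 : T.trace = ∑ i, ∑ j, a i * c i j ^ 2 := by
      nth_rw 1 [hTU]
      rw [Matrix.trace_mul_comm, ← Matrix.mul_assoc, hU1, Matrix.one_mul, trace_diagonal]
      simp only [← Finset.mul_sum, hrow, mul_one]
    have e4 : A.trace = ∑ i, ∑ j, b j * c i j ^ 2 := by
      nth_rw 1 [hAV]
      rw [Matrix.trace_mul_comm, ← Matrix.mul_assoc, hV1, Matrix.one_mul, trace_diagonal,
        Finset.sum_comm]
      simp only [← Finset.mul_sum, hcol, mul_one]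
    rw [relEntropy, e1, e2, e3, e4]
    simp only [← Finset.sum_sub_distrib, ← Finset.sum_add_distrib]
    refine Finset.sum_congr rfl fun i _ => Finset.sum_congr rfl fun j _ => ?_
    ring
  · intro s hs
    have key : ∀ w : Matrix n n ℝ, divergenceForm s (U * w * Vᵀ) T A =
        ∑ i, ∑ j, (2 * ((a i - b j) * c i j * w i j) -
          (s * a i + (1 - s) * b j) * w i j ^ 2) := by
      intro w
      have hVU : Vᵀ * U = cᵀ := by rw [hc, transpose_mul, transpose_transpose]
      have t1 : ((U * w * Vᵀ)ᵀ * T).trace = ∑ i, ∑ j, a i * c i j * w i j := by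
        have : ((U * w * Vᵀ)ᵀ * T).trace = (wᵀ * (diagonal a * c)).trace := by
          rw [transpose_mul, transpose_mul, transpose_transpose, hTU]
          simp only [Matrix.mul_assoc]
          rw [← Matrix.mul_assoc Uᵀ U, hU1, Matrix.one_mul, Matrix.trace_mul_comm]
          simp only [Matrix.mul_assoc, hc]
        rw [this, Finset.sum_comm, trace]
        refine Finset.sum_congr rfl fun j _ => ?_
        rw [diag_apply, Matrix.mul_apply]
        refine Finset.sum_congr rfl fun i _ => ?_
        rw [diagonal_mul, transpose_apply]
        ring
      have t2 : ((U * w * Vᵀ)ᵀ * A).trace = ∑ i, ∑ j, b j * c i j * w i j := by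
        have : ((U * w * Vᵀ)ᵀ * A).trace = (wᵀ * (c * diagonal b)).trace := by
          rw [transpose_mul, transpose_mul, transpose_transpose, hAV, Matrix.trace_mul_comm]
          simp only [Matrix.mul_assoc]
          rw [← Matrix.mul_assoc Vᵀ V, hV1, Matrix.one_mul, Matrix.trace_mul_comm V]
          simp only [Matrix.mul_assoc, hc]
          rw [Matrix.trace_mul_comm]
          simp only [Matrix.mul_assoc]
        rw [this, Finset.sum_comm, trace]
        refine Finset.sum_congr rfl fun j _ => ?_
        rw [diag_apply, Matrix.mul_apply]
        refine Finset.sum_congr rfl fun i _ => ?_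
        rw [mul_diagonal, transpose_apply]
        ring
      have t3 : ((U * w * Vᵀ)ᵀ * T * (U * w * Vᵀ)).trace = ∑ i, ∑ j, a i * w i j ^ 2 := by
        have : ((U * w * Vᵀ)ᵀ * T * (U * w * Vᵀ)).trace = (wᵀ * (diagonal a * w)).trace := by
          rw [transpose_mul, transpose_mul, transpose_transpose, hTU]
          simp only [Matrix.mul_assoc]
          rw [← Matrix.mul_assoc Uᵀ U, hU1, Matrix.one_mul, ← Matrix.mul_assoc Uᵀ U, hU1,
            Matrix.one_mul, Matrix.trace_mul_comm]
          simp only [Matrix.mul_assoc]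
          rw [hV1, Matrix.mul_one]
        rw [this, Finset.sum_comm, trace]
        refine Finset.sum_congr rfl fun j _ => ?_
        rw [diag_apply, Matrix.mul_apply]
        refine Finset.sum_congr rfl fun i _ => ?_
        rw [diagonal_mul, transpose_apply]
        ring
      have t4 : ((U * w * Vᵀ)ᵀ * (U * w * Vᵀ) * A).trace = ∑ i, ∑ j, b j * w i j ^ 2 := by
        have : ((U * w * Vᵀ)ᵀ * (U * w * Vᵀ) * A).trace = (wᵀ * (w * diagonal b)).trace := by
          rw [transpose_mul, transpose_mul, transpose_transpose, hAV]
          simp only [Matrix.mul_assoc]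
          rw [← Matrix.mul_assoc Uᵀ U, hU1, Matrix.one_mul, ← Matrix.mul_assoc Vᵀ V, hV1,
            Matrix.one_mul, Matrix.trace_mul_comm]
          simp only [Matrix.mul_assoc]
          rw [hV1, Matrix.mul_one]
        rw [this, Finset.sum_comm, trace]
        refine Finset.sum_congr rfl fun j _ => ?_
        rw [diag_apply, Matrix.mul_apply]
        refine Finset.sum_congr rfl fun i _ => ?_
        rw [mul_diagonal, transpose_apply]
        ring
      rw [divergenceForm, Matrix.mul_sub, trace_sub, t1, t2, t3, t4]
      simp only [← Finset.sum_sub_distrib, ← Finset.sum_add_distrib, Finset.mul_sum]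
      refine Finset.sum_congr rfl fun i _ => Finset.sum_congr rfl fun j _ => ?_
      ring
    constructor
    · refine ⟨U * Matrix.of (fun i j => (a i - b j) * c i j / (s * a i + (1 - s) * b j)) * Vᵀ, ?_⟩
      simp only [key, of_apply]
      refine Finset.sum_congr rfl fun i _ => Finset.sum_congr rfl fun j _ => ?_
      have := (interp_pos (ha i) (hb j) hs.1 hs.2).ne'
      field_simp
      ring
    · rintro _ ⟨W, rfl⟩
      have hW : W = U * (Uᵀ * W * V) * Vᵀ := by
        simp only [Matrix.mul_assoc]
        rw [hV2, Matrix.mul_one, ← Matrix.mul_assoc, hU2, Matrix.one_mul]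
      dsimp only
      rw [hW, key]
      refine Finset.sum_le_sum fun i _ => Finset.sum_le_sum fun j _ => ?_
      have := interp_pos (ha i) (hb j) hs.1 hs.2
      rw [div_mul_eq_mul_div, le_div_iff₀ this]
      nlinarith [sq_nonneg ((a i - b j) * c i j -
        (s * a i + (1 - s) * b j) * (Uᵀ * W * V) i j)]

/-- Lindblad's theorem: the relative entropy is jointly convex. -/
lemma relEntropy_combo_le {T₁ T₂ A₁ A₂ : Matrix n n ℝ} (hT₁ : T₁.PosDef) (hT₂ : T₂.PosDef)
    (hA₁ : A₁.PosDef) (hA₂ : A₂.PosDef) {p q : ℝ} (hp : 0 < p) (hq : 0 < q) :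
    relEntropy (p • T₁ + q • T₂) (p • A₁ + q • A₂) ≤
      p * relEntropy T₁ A₁ + q * relEntropy T₂ A₂ := by
  obtain ⟨φ₁, hc₁, h₁, hs₁⟩ := relEntropy_eq_integral hT₁ hA₁
  obtain ⟨φ₂, hc₂, h₂, hs₂⟩ := relEntropy_eq_integral hT₂ hA₂
  obtain ⟨φ, hc, h, hs⟩ := relEntropy_eq_integral ((hT₁.smul hp).add (hT₂.smul hq))
    ((hA₁.smul hp).add (hA₂.smul hq))
  have hint : ∀ {ψ : ℝ → ℝ}, ContinuousOn ψ (Set.Icc 0 1) →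
      IntervalIntegrable (fun s => (1 - s) * ψ s) volume 0 1 := fun hψ => by
    apply ContinuousOn.intervalIntegrable
    rw [Set.uIcc_of_le zero_le_one]
    exact ContinuousOn.mul (by fun_prop) hψ
  rw [h, h₁, h₂, ← intervalIntegral.integral_const_mul, ← intervalIntegral.integral_const_mul,
    ← intervalIntegral.integral_add ((hint hc₁).const_mul p) ((hint hc₂).const_mul q)]
  refine intervalIntegral.integral_mono_on zero_le_one (hint hc)
    (((hint hc₁).const_mul p).add ((hint hc₂).const_mul q)) fun s hs' => ?_
  obtain ⟨W, hW⟩ := (hs s hs').1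
  have b₁ := (hs₁ s hs').2 ⟨W, rfl⟩
  have b₂ := (hs₂ s hs').2 ⟨W, rfl⟩
  dsimp only at hW b₁ b₂
  rw [divergenceForm_combo] at hW
  have h1s : 0 ≤ 1 - s := by linarith [hs'.2]
  calc (1 - s) * φ s ≤ (1 - s) * (p * φ₁ s + q * φ₂ s) := by
        refine mul_le_mul_of_nonneg_left ?_ h1s
        rw [← hW]
        gcongr
    _ = p * ((1 - s) * φ₁ s) + q * ((1 - s) * φ₂ s) := by ring

/-- Lieb's concavity theorem for the trace exponential. -/
theorem concaveOn_trace_exp_add_log {H : Matrix n n ℝ} (hH : H.IsHermitian) :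
    ConcaveOn ℝ {A : Matrix n n ℝ | A.PosDef}
      (fun A => (cfc Real.exp (H + cfc Real.log A)).trace) := by
  refine concaveOn_iff_forall_pos.2 ⟨?_, ?_⟩
  · refine convex_iff_forall_pos.2 fun A hA B hB p q hp hq _ => ?_
    exact (PosDef.smul hA hp).add (PosDef.smul hB hq)
  · intro A₁ hA₁ A₂ hA₂ p q hp hq hpq
    have hA : (p • A₁ + q • A₂).PosDef := (PosDef.smul hA₁ hp).add (PosDef.smul hA₂ hq)
    have hK : ∀ A : Matrix n n ℝ, (H + cfc Real.log A).IsHermitian := fun A =>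
      hH.add (isHermitian_cfc _ _)
    have hT : ∀ A : Matrix n n ℝ, (cfc Real.exp (H + cfc Real.log A)).PosDef := fun A =>
      posDef_cfc_exp _ (hK A)
    -- For the maximizer `T = exp (H + log A)` the Gibbs inequality is an equality.
    have heq : ∀ A : Matrix n n ℝ, (cfc Real.exp (H + cfc Real.log A)).trace =
        (cfc Real.exp (H + cfc Real.log A) * H).trace + A.trace -
          relEntropy (cfc Real.exp (H + cfc Real.log A)) A := by
      intro A
      rw [relEntropy, cfc_log_cfc_exp (hK A), Matrix.mul_add, trace_add]
      ring
    have hg := gibbs_le_trace_exp (((hT A₁).smul hp).add ((hT A₂).smul hq))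
      (hK (p • A₁ + q • A₂))
    have hr := relEntropy_combo_le (hT A₁) (hT A₂) hA₁ hA₂ hp hq
    simp only [smul_eq_mul]
    rw [heq A₁, heq A₂]
    set T := p • cfc Real.exp (H + cfc Real.log A₁) + q • cfc Real.exp (H + cfc Real.log A₂)
      with hTdef
    have hTH : (T * H).trace = p * (cfc Real.exp (H + cfc Real.log A₁) * H).trace +
        q * (cfc Real.exp (H + cfc Real.log A₂) * H).trace := by
      simp [hTdef, Matrix.add_mul, trace_add]
    have hAt : (p • A₁ + q • A₂).trace = p * A₁.trace + q * A₂.trace := by simp [trace_add]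
    rw [Matrix.mul_add, trace_add] at hg
    unfold relEntropy at hr ⊢
    linarith

end Lieb

/-! ### Measurability of the functional calculus and the Loewner order -/

instance matrixBorelSpace {m n : Type*} [Finite m] [Finite n] : BorelSpace (Matrix m n ℝ) :=
  inferInstanceAs (BorelSpace (m → n → ℝ))

instance matrixMeasurableAdd₂ {m n : Type*} : MeasurableAdd₂ (Matrix m n ℝ) :=
  inferInstanceAs (MeasurableAdd₂ (m → n → ℝ))

lemma measurable_matrix_of {m n Ω : Type*} [MeasurableSpace Ω] {A : Ω → Matrix m n ℝ}
    (h : ∀ i j, Measurable fun ω => A ω i j) : Measurable A :=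
  measurable_pi_lambda _ fun i => measurable_pi_lambda _ fun j => h i j

lemma measurable_entry {m n : Type*} (i : m) (j : n) :
    Measurable fun A : Matrix m n ℝ => A i j :=
  (measurable_pi_apply j).comp (measurable_pi_apply i)

section Measurability

open scoped Matrix.Norms.L2Operator

variable {n : Type*} [Fintype n] [DecidableEq n]

lemma isClosed_isHermitian {n : Type*} : IsClosed {A : Matrix n n ℝ | A.IsHermitian} :=
  isClosed_eq (continuous_id.matrix_conjTranspose) continuous_id

lemma continuousOn_cfc_isHermitian {f : ℝ → ℝ} (hf : Continuous f) :
    ContinuousOn (fun A : Matrix n n ℝ => cfc f A) {A | A.IsHermitian} :=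
  ContinuousOn.cfc_of_mem_nhdsSet (s := Set.univ) f Filter.univ_mem continuousOn_id
    (fun _ h => h) hf.continuousOn

/-- On matrices that are not symmetric the functional calculus takes the junk value `0`. -/
lemma measurable_cfc {f : ℝ → ℝ} (hf : Continuous f) :
    Measurable (fun A : Matrix n n ℝ => cfc f A) := by
  classical
  have h : (fun A : Matrix n n ℝ => cfc f A) =
      {A : Matrix n n ℝ | A.IsHermitian}.piecewise (fun A => cfc f A) (fun _ => 0) := by
    ext1 A
    by_cases hA : A ∈ {A : Matrix n n ℝ | A.IsHermitian}
    · rw [Set.piecewise_eq_of_mem _ _ _ hA]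
    · rw [Set.piecewise_eq_of_notMem _ _ _ hA]
      exact cfc_apply_of_not_predicate A hA
  rw [h]
  exact (continuousOn_cfc_isHermitian hf).measurable_piecewise continuousOn_const
    isClosed_isHermitian.measurableSet

lemma measurable_trace_exp : Measurable fun A : Matrix n n ℝ => (cfc Real.exp A).trace :=
  (Continuous.matrix_trace continuous_id).measurable.comp (measurable_cfc Real.continuous_exp)

end Measurability

section Order

variable {n : Type*} [Fintype n] [DecidableEq n]

lemma posSemidef_cfc {A : Matrix n n ℝ} (hA : A.IsHermitian) {f : ℝ → ℝ}
    (hf : ∀ x ∈ spectrum ℝ A, 0 ≤ f x) : (cfc f A).PosSemidef := by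
  obtain ⟨U, a, -, -, ha, -, hU⟩ := exists_diagonalization hA
  rw [hU]
  have h : (diagonal (fun i => f (a i))).PosSemidef := PosSemidef.diagonal fun i => hf _ (ha i)
  simpa [conjTranspose_eq_transpose_of_trivial] using h.mul_mul_conjTranspose_same U

lemma posSemidef_cfc_sub_cfc {A : Matrix n n ℝ} (hA : A.IsHermitian) {f g : ℝ → ℝ}
    (hfg : ∀ x ∈ spectrum ℝ A, f x ≤ g x) : (cfc g A - cfc f A).PosSemidef := by
  have hfin : (spectrum ℝ A).Finite := Matrix.finite_real_spectrum
  rw [← cfc_sub g f A (hfin.continuousOn _) (hfin.continuousOn _)]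
  exact posSemidef_cfc hA fun x hx => sub_nonneg.2 (hfg x hx)

lemma nonneg_of_mem_spectrum {A : Matrix n n ℝ} (hA : A.PosSemidef) {x : ℝ}
    (hx : x ∈ spectrum ℝ A) : 0 ≤ x := by
  rw [hA.isHermitian.spectrum_real_eq_range_eigenvalues] at hx
  obtain ⟨i, rfl⟩ := hx
  exact hA.eigenvalues_nonneg i

lemma cfc_add_const_eq {A : Matrix n n ℝ} (hA : A.IsHermitian) (c : ℝ) :
    cfc (fun x => x + c) A = A + c • (1 : Matrix n n ℝ) := by
  have hA' : IsSelfAdjoint A := hA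
  rw [cfc_add_const c (fun x => x) A, cfc_id' ℝ A, Algebra.algebraMap_eq_smul_one]

lemma le_of_mem_spectrum {A : Matrix n n ℝ} {c : ℝ} (hA : A.IsHermitian)
    (h : (A - c • (1 : Matrix n n ℝ)).PosSemidef) {x : ℝ} (hx : x ∈ spectrum ℝ A) : c ≤ x := by
  have hA' : IsSelfAdjoint A := hA
  have h1 := cfc_add_const_eq hA (-c)
  rw [neg_smul, ← sub_eq_add_neg] at h1
  rw [← h1] at h
  have h2 : x + -c ∈ spectrum ℝ (cfc (fun x => x + -c) A) := by
    rw [cfc_map_spectrum (fun x : ℝ => x + -c) A]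
    exact ⟨x, hx, rfl⟩
  linarith [nonneg_of_mem_spectrum h h2]

lemma le_trace_of_mem_spectrum {A : Matrix n n ℝ} (hA : A.PosSemidef) {x : ℝ}
    (hx : x ∈ spectrum ℝ A) : x ≤ A.trace := by
  rw [hA.isHermitian.spectrum_real_eq_range_eigenvalues] at hx
  obtain ⟨i, rfl⟩ := hx
  rw [hA.isHermitian.trace_eq_sum_eigenvalues]
  exact Finset.single_le_sum (f := fun i => hA.isHermitian.eigenvalues i)
    (fun j _ => hA.eigenvalues_nonneg j) (Finset.mem_univ i)

lemma isHermitian_smul_one {n : Type*} [DecidableEq n] (c : ℝ) : (c • (1 : Matrix n n ℝ)).IsHermitian := by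
  rw [IsHermitian, conjTranspose_smul, conjTranspose_one, star_trivial]

lemma trace_exp_add_smul_one {H : Matrix n n ℝ} (hH : H.IsHermitian) (c : ℝ) :
    (cfc Real.exp (H + c • (1 : Matrix n n ℝ))).trace =
      Real.exp c * (cfc Real.exp H).trace := by
  have hH' : IsSelfAdjoint H := hH
  rw [← cfc_add_const_eq hH, ← cfc_comp' Real.exp (fun x => x + c) H]
  simp only [Real.exp_add, mul_comm _ (Real.exp c)]
  rw [cfc_const_mul (Real.exp c) Real.exp H, Matrix.trace_smul, smul_eq_mul]

lemma trace_exp_nonneg (K : Matrix n n ℝ) : 0 ≤ (cfc Real.exp K).trace := by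
  by_cases hK : K.IsHermitian
  · exact (posDef_cfc_exp K hK).posSemidef.trace_nonneg
  · rw [cfc_apply_of_not_predicate (p := IsSelfAdjoint) (f := Real.exp) K hK, trace_zero]

lemma posDef_of_posSemidef_sub {n : Type*} [DecidableEq n] {A : Matrix n n ℝ} {c : ℝ} (hc : 0 < c)
    (h : (A - c • (1 : Matrix n n ℝ)).PosSemidef) : A.PosDef := by
  simpa using ((PosDef.one (n := n) (R := ℝ)).smul hc).add_posSemidef h

end Order

/-! ### The trace moment generating function of a sum of independent matrices -/

section Jensen

open scoped Matrix.Norms.L2Operator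

variable {n : Type*} [Fintype n] [DecidableEq n]

/-- The closed convex set of symmetric matrices with spectrum in `[1/2, ∞)`. The values of
`1 + x + x² / 2` lie in this interval, and the logarithm is continuous on it. -/
def halfSet (n : Type*) [DecidableEq n] : Set (Matrix n n ℝ) :=
  {A | (A - (1 / 2 : ℝ) • (1 : Matrix n n ℝ)).PosSemidef}

lemma posDef_of_mem_halfSet {n : Type*} [DecidableEq n] {A : Matrix n n ℝ} (hA : A ∈ halfSet n) : A.PosDef :=
  posDef_of_posSemidef_sub (by norm_num) hA

lemma isClosed_posSemidef {n : Type*} [Fintype n] : IsClosed {A : Matrix n n ℝ | A.PosSemidef} := by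
  have h : {A : Matrix n n ℝ | A.PosSemidef} =
      {A | A.IsHermitian} ∩ ⋂ x : n → ℝ, {A | 0 ≤ x ⬝ᵥ (A *ᵥ x)} := by
    ext A
    simp [posSemidef_iff_dotProduct_mulVec]
  rw [h]
  refine isClosed_isHermitian.inter (isClosed_iInter fun x => isClosed_le continuous_const ?_)
  exact continuous_const.dotProduct (continuous_id.matrix_mulVec continuous_const)

lemma isClosed_halfSet : IsClosed (halfSet n) :=
  isClosed_posSemidef.preimage (continuous_id.sub continuous_const)

lemma convex_halfSet {n : Type*} [DecidableEq n] : Convex ℝ (halfSet n) := by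
  intro A hA B hB p q hp hq hpq
  have h := (PosSemidef.smul hA hp).add (PosSemidef.smul hB hq)
  have e : p • (A - (1 / 2 : ℝ) • (1 : Matrix n n ℝ)) + q • (B - (1 / 2 : ℝ) • (1 : Matrix n n ℝ))
      = p • A + q • B - (1 / 2 : ℝ) • (1 : Matrix n n ℝ) := by
    calc _ = p • A + q • B - (p + q) • (1 / 2 : ℝ) • (1 : Matrix n n ℝ) := by
          rw [add_smul, smul_sub, smul_sub]
          abel
      _ = _ := by rw [hpq, one_smul]
  rwa [e] at h

/-- On `halfSet n` the logarithm may be replaced by a function that is continuous on `ℝ`. -/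
lemma cfc_log_eq {A : Matrix n n ℝ} (hA : A ∈ halfSet n) :
    cfc Real.log A = cfc (fun x => Real.log (max x (1 / 2))) A := by
  refine cfc_congr fun x hx => ?_
  rw [max_eq_left (le_of_mem_spectrum (posDef_of_mem_halfSet hA).isHermitian hA hx)]

lemma continuous_log_max : Continuous fun x : ℝ => Real.log (max x (1 / 2)) :=
  Continuous.log (by fun_prop) fun x => (lt_max_of_lt_right (by norm_num)).ne'

lemma continuousOn_trace_exp_add_log {H : Matrix n n ℝ} (hH : H.IsHermitian) :
    ContinuousOn (fun A => (cfc Real.exp (H + cfc Real.log A)).trace) (halfSet n) := by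
  have h1 : ContinuousOn (fun A => H + cfc Real.log A) (halfSet n) := by
    refine continuousOn_const.add (ContinuousOn.congr ?_ fun A hA => cfc_log_eq hA)
    exact (continuousOn_cfc_isHermitian continuous_log_max).mono
      fun A hA => (posDef_of_mem_halfSet hA).isHermitian
  have h2 : ContinuousOn (fun A => cfc Real.exp (H + cfc Real.log A)) (halfSet n) :=
    (continuousOn_cfc_isHermitian Real.continuous_exp).comp h1
      fun A _ => hH.add (isHermitian_cfc _ _)
  exact (Continuous.matrix_trace continuous_id).comp_continuousOn h2

lemma trace_exp_add_log_le {H A : Matrix n n ℝ} (hH : H.IsHermitian) (hA : A.PosDef) :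
    (cfc Real.exp (H + cfc Real.log A)).trace ≤ (A.trace + 1) * (cfc Real.exp H).trace := by
  have htr : 0 < A.trace + 1 := by linarith [hA.posSemidef.trace_nonneg]
  have hA' : IsSelfAdjoint A := hA.isHermitian
  rw [← Real.exp_log htr, ← trace_exp_add_smul_one hH]
  refine trace_exp_le_trace_exp (hH.add (isHermitian_cfc _ _))
    (hH.add (isHermitian_smul_one _)) ?_
  rw [add_sub_add_left_eq_sub, ← Algebra.algebraMap_eq_smul_one,
    ← cfc_const (R := ℝ) (Real.log (A.trace + 1)) A]
  refine posSemidef_cfc_sub_cfc hA.isHermitian fun x hx => ?_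
  exact Real.log_le_log (spectrum_pos_of_posDef hA hx)
    (by linarith [le_trace_of_mem_spectrum hA.posSemidef hx])

/-- Jensen's inequality for Lieb's concave function. -/
lemma lintegral_trace_exp_add_log_le {Ω : Type*} [MeasurableSpace Ω] {μ : Measure Ω}
    [IsProbabilityMeasure μ] {H : Matrix n n ℝ} (hH : H.IsHermitian) {A : Ω → Matrix n n ℝ}
    (hA : Measurable A) (hAs : ∀ ω, A ω ∈ halfSet n)
    (hint : ∀ i j, Integrable (fun ω => A ω i j) μ) :
    (Matrix.of fun i j => ∫ ω, A ω i j ∂μ) ∈ halfSet n ∧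
    ∫⁻ ω, ENNReal.ofReal (cfc Real.exp (H + cfc Real.log (A ω))).trace ∂μ ≤
      ENNReal.ofReal
        (cfc Real.exp (H + cfc Real.log (Matrix.of fun i j => ∫ ω, A ω i j ∂μ))).trace := by
  have hAi : Integrable A μ := by
    have : A = fun ω => ∑ i, ∑ j, A ω i j • Matrix.single i j (1 : ℝ) := by
      ext1 ω
      conv_lhs => rw [matrix_eq_sum_single (A ω)]
      simp [smul_single]
    rw [this]
    exact integrable_finsetSum _ fun i _ => integrable_finsetSum _ fun j _ =>
      (hint i j).smul_const _
  have hmean : (Matrix.of fun i j => ∫ ω, A ω i j ∂μ) = ∫ ω, A ω ∂μ := by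
    ext i j
    let ℓ : Matrix n n ℝ →L[ℝ] ℝ := LinearMap.toContinuousLinearMap (Matrix.entryLinearMap ℝ ℝ i j)
    exact ℓ.integral_comp_comm hAi
  have hgm : Measurable fun ω => (cfc Real.exp (H + cfc Real.log (A ω))).trace := by
    simp only [fun ω => cfc_log_eq (hAs ω)]
    exact measurable_trace_exp.comp
      (((measurable_cfc continuous_log_max).comp hA).const_add H)
  have hgi : Integrable (fun ω => (cfc Real.exp (H + cfc Real.log (A ω))).trace) μ := by
    have htr : Integrable (fun ω => (A ω).trace) μ := by
      simpa [trace] using integrable_finsetSum Finset.univ fun i _ => hint i i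
    refine ((htr.add (integrable_const 1)).mul_const (cfc Real.exp H).trace).mono'
      hgm.aestronglyMeasurable (Filter.Eventually.of_forall fun ω => ?_)
    rw [Real.norm_of_nonneg (trace_exp_nonneg _)]
    exact trace_exp_add_log_le hH (posDef_of_mem_halfSet (hAs ω))
  rw [hmean]
  refine ⟨convex_halfSet.integral_mem isClosed_halfSet (Filter.Eventually.of_forall hAs) hAi, ?_⟩
  rw [← ofReal_integral_eq_lintegral_ofReal hgi
    (Filter.Eventually.of_forall fun ω => trace_exp_nonneg _)]
  refine ENNReal.ofReal_le_ofReal ?_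
  exact ((concaveOn_trace_exp_add_log hH).subset (fun A hA => posDef_of_mem_halfSet hA)
    convex_halfSet).le_map_integral (continuousOn_trace_exp_add_log hH) isClosed_halfSet
    (Filter.Eventually.of_forall hAs) hAi hgi

end Jensen

section Catoni

variable {n : Type*} [Fintype n] [DecidableEq n]

lemma half_le_quadratic (x : ℝ) : 1 / 2 ≤ 1 + x + x ^ 2 / 2 := by
  nlinarith [sq_nonneg (x + 1)]

lemma continuous_catoni : Continuous catoni := by
  refine Continuous.if_le ?_ ?_ continuous_const continuous_id ?_
  · exact Continuous.log (by fun_prop) fun x => by nlinarith [half_le_quadratic x]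
  · exact (Continuous.log (by fun_prop) fun x => by nlinarith [half_le_quadratic (-x)]).neg
  · rintro x rfl
    simp

lemma catoni_neg (x : ℝ) : catoni (-x) = -catoni x := by
  rcases lt_trichotomy x 0 with h | rfl | h
  · have : ¬ 0 ≤ x := not_le.2 h
    have h' : 0 ≤ -x := by linarith
    simp [catoni, this, h']
    ring_nf
  · simp [catoni]
  · have : ¬ 0 ≤ -x := by linarith
    simp [catoni, this, h.le]

lemma catoni_le_log (x : ℝ) : catoni x ≤ Real.log (1 + x + x ^ 2 / 2) := by
  unfold catoni
  split_ifs with h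
  · exact le_rfl
  · have h1 : 0 < 1 - x + x ^ 2 / 2 := by nlinarith [half_le_quadratic (-x)]
    rw [← Real.log_inv]
    refine Real.log_le_log (inv_pos.2 h1) ?_
    rw [inv_le_iff_one_le_mul₀ h1]
    nlinarith [sq_nonneg (x ^ 2)]

lemma cfc_quadratic {Z : Matrix n n ℝ} (hZ : Z.IsHermitian) :
    cfc (fun x : ℝ => 1 + x + x ^ 2 / 2) Z = 1 + Z + (1 / 2 : ℝ) • (Z * Z) := by
  have hZ' : IsSelfAdjoint Z := hZ
  have e : (fun x : ℝ => 1 + x + x ^ 2 / 2) = fun x => (1 + x) + (1 / 2 : ℝ) * x ^ 2 := by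
    ext x; ring
  rw [e, cfc_add Z (fun x : ℝ => 1 + x) (fun x : ℝ => (1 / 2 : ℝ) * x ^ 2),
    cfc_const_mul (1 / 2 : ℝ) (fun x => x ^ 2) Z, cfc_pow_id (R := ℝ) Z 2,
    cfc_add Z (fun _ : ℝ => 1) (fun x : ℝ => x), cfc_const_one ℝ Z, cfc_id' ℝ Z, pow_two]

/-- One step of the moment generating function bound: averaging over a symmetric random matrix
with mean `S` and second moment at most `v` replaces Catoni's transform by `S + (v / 2)`. -/
lemma lintegral_trace_exp_catoni_le {Ω : Type*} [MeasurableSpace Ω] {μ : Measure Ω}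
    [IsProbabilityMeasure μ] {H : Matrix n n ℝ} (hH : H.IsHermitian) {Z : Ω → Matrix n n ℝ}
    (hZ : Measurable Z) (hZh : ∀ ω, (Z ω).IsHermitian)
    (hint : ∀ i j, Integrable (fun ω => Z ω i j) μ)
    (hint₂ : ∀ i j, Integrable (fun ω => (Z ω * Z ω) i j) μ)
    {S : Matrix n n ℝ} (hSh : S.IsHermitian) (hS : ∀ i j, ∫ ω, Z ω i j ∂μ = S i j) {v : ℝ}
    (hv : (v • (1 : Matrix n n ℝ) - Matrix.of fun i j => ∫ ω, (Z ω * Z ω) i j ∂μ).PosSemidef) :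
    ∫⁻ ω, ENNReal.ofReal (cfc Real.exp (H + cfc catoni (Z ω))).trace ∂μ ≤
      ENNReal.ofReal (cfc Real.exp (H + (S + (v / 2) • (1 : Matrix n n ℝ)))).trace := by
  set V : Matrix n n ℝ := Matrix.of fun i j => ∫ ω, (Z ω * Z ω) i j ∂μ with hV
  set A : Ω → Matrix n n ℝ := fun ω => 1 + Z ω + (1 / 2 : ℝ) • (Z ω * Z ω) with hA
  have hAm : Measurable A := by
    refine measurable_matrix_of fun i j => ?_
    have he : ∀ i j, Measurable fun ω => Z ω i j := fun i j => (measurable_entry i j).comp hZ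
    simp only [hA, Matrix.add_apply, Matrix.smul_apply, Matrix.mul_apply, smul_eq_mul]
    fun_prop
  have hAs : ∀ ω, A ω ∈ halfSet n := fun ω => by
    have hZ' : IsSelfAdjoint (Z ω) := hZh ω
    change (1 + Z ω + (1 / 2 : ℝ) • (Z ω * Z ω) - (1 / 2 : ℝ) • (1 : Matrix n n ℝ)).PosSemidef
    rw [← cfc_quadratic (hZh ω), ← Algebra.algebraMap_eq_smul_one, ← cfc_const (R := ℝ) (1 / 2) (Z ω)]
    exact posSemidef_cfc_sub_cfc (hZh ω) fun x _ => half_le_quadratic x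
  have hAi : ∀ i j, Integrable (fun ω => A ω i j) μ := fun i j => by
    simp only [hA, Matrix.add_apply, Matrix.smul_apply, smul_eq_mul]
    exact ((integrable_const _).add (hint i j)).add ((hint₂ i j).const_mul _)
  have hmean : (Matrix.of fun i j => ∫ ω, A ω i j ∂μ) = 1 + S + (1 / 2 : ℝ) • V := by
    ext i j
    simp only [hA, of_apply, Matrix.add_apply, Matrix.smul_apply, smul_eq_mul, hV]
    refine (integral_add ((integrable_const _).add (hint i j)) ((hint₂ i j).const_mul _)).trans ?_
    rw [integral_const_mul, ← hS]
    congr 1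
    refine (integral_add (integrable_const _) (hint i j)).trans ?_
    simp
  obtain ⟨hmem, hle⟩ := lintegral_trace_exp_add_log_le hH hAm hAs hAi
  rw [hmean] at hmem hle
  refine (lintegral_mono fun ω => ENNReal.ofReal_le_ofReal ?_).trans
    (hle.trans (ENNReal.ofReal_le_ofReal ?_))
  · have hZ' : IsSelfAdjoint (Z ω) := hZh ω
    refine trace_exp_le_trace_exp (hH.add (isHermitian_cfc _ _)) (hH.add (isHermitian_cfc _ _)) ?_
    rw [add_sub_add_left_eq_sub, hA]
    dsimp only
    rw [← cfc_quadratic (hZh ω), ← cfc_comp' Real.log (fun x : ℝ => 1 + x + x ^ 2 / 2) (Z ω)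
      ((Matrix.finite_real_spectrum.image _).continuousOn _)]
    exact posSemidef_cfc_sub_cfc (hZh ω) fun x _ => catoni_le_log x
  · refine trace_exp_le_trace_exp (hH.add (isHermitian_cfc _ _))
      (hH.add (hSh.add (isHermitian_smul_one _))) ?_
    -- `log M ≤ M - 1`, so that no operator monotonicity of the logarithm is needed.
    have hM := (posDef_of_mem_halfSet hmem)
    have h1 : ((1 + S + (1 / 2 : ℝ) • V) + (-1 : ℝ) • (1 : Matrix n n ℝ) -
        cfc Real.log (1 + S + (1 / 2 : ℝ) • V)).PosSemidef := by
      rw [← cfc_add_const_eq hM.isHermitian (-1)]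
      refine posSemidef_cfc_sub_cfc hM.isHermitian fun x hx => ?_
      linarith [Real.log_le_sub_one_of_pos (spectrum_pos_of_posDef hM hx)]
    have h2 := h1.add (hv.smul (by norm_num : (0 : ℝ) ≤ 1 / 2))
    convert! h2 using 1
    rw [smul_sub, smul_smul, neg_smul, one_smul]
    have : 1 / 2 * v = v / 2 := by ring
    rw [this]
    abel

/-- Iterating a one-step bound on the trace moment generating function over independent symmetric
random matrices. -/
lemma lintegral_trace_exp_sum_le {Ω ι : Type*} [MeasurableSpace Ω] {μ : Measure Ω}
    [IsProbabilityMeasure μ] {L : ι → Ω → Matrix n n ℝ} (hL : ∀ i, Measurable (L i))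
    (hLh : ∀ i ω, (L i ω).IsHermitian) (hind : iIndepFun L μ) {C : Matrix n n ℝ}
    (hC : C.IsHermitian)
    (hstep : ∀ i (H : Matrix n n ℝ), H.IsHermitian →
      ∫⁻ ω, ENNReal.ofReal (cfc Real.exp (H + L i ω)).trace ∂μ ≤
        ENNReal.ofReal (cfc Real.exp (H + C)).trace)
    (s : Finset ι) (H : Matrix n n ℝ) (hH : H.IsHermitian) :
    ∫⁻ ω, ENNReal.ofReal (cfc Real.exp (H + ∑ i ∈ s, L i ω)).trace ∂μ ≤
      ENNReal.ofReal (cfc Real.exp (H + (s.card : ℝ) • C)).trace := by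
  classical
  induction s using Finset.induction_on generalizing H with
  | empty => simp
  | insert k s hk ih =>
    have hF : Measurable fun p : Matrix n n ℝ × Matrix n n ℝ =>
        ENNReal.ofReal (cfc Real.exp (H + (p.1 + p.2))).trace :=
      (measurable_trace_exp.comp ((measurable_fst.add measurable_snd).const_add H)).ennreal_ofReal
    have hsum : Measurable fun ω => ∑ i ∈ s, L i ω :=
      Finset.measurable_fun_sum s fun i _ => hL i
    have hi : IndepFun (fun ω => ∑ i ∈ s, L i ω) (L k) μ := by
      have := hind.indepFun_finsetSum_of_notMem hL hk
      rwa [Finset.sum_fn] at this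
    have hmap := (indepFun_iff_map_prod_eq_prod_map_map hsum.aemeasurable (hL k).aemeasurable).1 hi
    have : IsProbabilityMeasure (μ.map (L k)) :=
      Measure.isProbabilityMeasure_map (hL k).aemeasurable
    calc ∫⁻ ω, ENNReal.ofReal (cfc Real.exp (H + ∑ i ∈ insert k s, L i ω)).trace ∂μ
        = ∫⁻ ω, ENNReal.ofReal (cfc Real.exp (H + (∑ i ∈ s, L i ω + L k ω))).trace ∂μ := by
          simp only [Finset.sum_insert hk, add_comm (L k _)]
      _ = ∫⁻ p, ENNReal.ofReal (cfc Real.exp (H + (p.1 + p.2))).trace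
            ∂(μ.map fun ω => (∑ i ∈ s, L i ω, L k ω)) :=
          (lintegral_map hF (hsum.prodMk (hL k))).symm
      _ = ∫⁻ x, ∫⁻ y, ENNReal.ofReal (cfc Real.exp (H + (x + y))).trace ∂(μ.map (L k))
            ∂(μ.map fun ω => ∑ i ∈ s, L i ω) := by
          rw [hmap, lintegral_prod _ hF.aemeasurable]
      _ = ∫⁻ ω, ∫⁻ y, ENNReal.ofReal (cfc Real.exp (H + (∑ i ∈ s, L i ω + y))).trace
            ∂(μ.map (L k)) ∂μ := lintegral_map hF.lintegral_prod_right' hsum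
      _ ≤ ∫⁻ ω, ENNReal.ofReal (cfc Real.exp ((H + C) + ∑ i ∈ s, L i ω)).trace ∂μ := by
          refine lintegral_mono fun ω => ?_
          refine (lintegral_map (hF.comp measurable_prodMk_left) (hL k)).trans_le ?_
          have hh : (H + ∑ i ∈ s, L i ω).IsHermitian := by
            refine hH.add ?_
            rw [IsHermitian, conjTranspose_sum]
            exact Finset.sum_congr rfl fun i _ => hLh i ω
          calc _ = ∫⁻ ω', ENNReal.ofReal (cfc Real.exp ((H + ∑ i ∈ s, L i ω) + L k ω')).trace ∂μ :=
                lintegral_congr fun ω' => by rw [add_assoc H]; rfl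
            _ ≤ _ := hstep k _ hh
            _ = _ := by rw [add_right_comm]
      _ ≤ ENNReal.ofReal (cfc Real.exp ((H + C) + (s.card : ℝ) • C)).trace := ih _ (hH.add hC)
      _ = _ := by
          rw [Finset.card_insert_of_notMem hk]
          push_cast
          rw [add_smul, one_smul, add_assoc, add_comm C]

end Catoni

/-! ### Hard thresholding of a small perturbation of a low-rank matrix -/

section Deterministic

variable {d₁ d₂ : ℕ}

lemma opNorm_mulVec_le (A : Matrix (Fin d₁) (Fin d₂) ℝ) (v : Fin d₂ → ℝ) :
    (A *ᵥ v) ⬝ᵥ (A *ᵥ v) ≤ opNorm A ^ 2 * (v ⬝ᵥ v) := by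
  have h := (LinearMap.toContinuousLinearMap (Matrix.toEuclideanLin A)).le_opNorm
    (WithLp.toLp 2 v)
  have h2 := pow_le_pow_left₀ (norm_nonneg _) h 2
  rw [mul_pow] at h2
  rw [EuclideanSpace.real_norm_sq_eq, EuclideanSpace.real_norm_sq_eq] at h2
  simpa [opNorm, dotProduct, pow_two] using h2

lemma opNorm_le_of_mulVec (A : Matrix (Fin d₁) (Fin d₂) ℝ) {c : ℝ} (hc : 0 ≤ c)
    (h : ∀ v : Fin d₂ → ℝ, (A *ᵥ v) ⬝ᵥ (A *ᵥ v) ≤ c ^ 2 * (v ⬝ᵥ v)) : opNorm A ≤ c := by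
  refine ContinuousLinearMap.opNorm_le_bound _ hc fun v => ?_
  refine le_of_sq_le_sq ?_ (by positivity)
  rw [mul_pow, EuclideanSpace.real_norm_sq_eq, EuclideanSpace.real_norm_sq_eq]
  simpa [dotProduct, pow_two] using h v.ofLp

lemma opNorm_nonneg (A : Matrix (Fin d₁) (Fin d₂) ℝ) : 0 ≤ opNorm A := norm_nonneg _

lemma opNorm_add_le (A C : Matrix (Fin d₁) (Fin d₂) ℝ) : opNorm (A + C) ≤ opNorm A + opNorm C := by
  simpa [opNorm] using norm_add_le (LinearMap.toContinuousLinearMap (Matrix.toEuclideanLin A))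
    (LinearMap.toContinuousLinearMap (Matrix.toEuclideanLin C))

/-- The right singular vectors, the squared singular values, and hard thresholding in terms of
them. -/
lemma exists_right_svd (τ : ℝ) (M : Matrix (Fin d₁) (Fin d₂) ℝ) :
    ∃ (V : Matrix (Fin d₂) (Fin d₂) ℝ) (a : Fin d₂ → ℝ), Vᵀ * V = 1 ∧ V * Vᵀ = 1 ∧
      (∀ i, 0 ≤ a i) ∧ (∀ v, (M *ᵥ v) ⬝ᵥ (M *ᵥ v) = ∑ i, a i * (Vᵀ *ᵥ v) i ^ 2) ∧
      hardThreshold τ M =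
        M * (V * diagonal (fun i => if τ < Real.sqrt (a i) then (1 : ℝ) else 0) * Vᵀ) := by
  have hPSD : (Mᵀ * M).PosSemidef := by
    simpa [conjTranspose_eq_transpose_of_trivial] using posSemidef_conjTranspose_mul_self M
  obtain ⟨V, a, h1, h2, ha, hM, hf⟩ := exists_diagonalization hPSD.isHermitian
  refine ⟨V, a, h1, h2, fun i => nonneg_of_mem_spectrum hPSD (ha i), fun v => ?_, ?_⟩
  · have e : (M *ᵥ v) ⬝ᵥ (M *ᵥ v) = (Vᵀ *ᵥ v) ⬝ᵥ (diagonal a *ᵥ (Vᵀ *ᵥ v)) := by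
      have e1 : (M *ᵥ v) ⬝ᵥ (M *ᵥ v) = v ⬝ᵥ ((Mᵀ * M) *ᵥ v) := by
        rw [← mulVec_mulVec, dotProduct_mulVec v Mᵀ, vecMul_transpose]
      rw [e1, hM, ← mulVec_mulVec, ← mulVec_mulVec,
        dotProduct_mulVec v V, ← mulVec_transpose]
    rw [e, dotProduct]
    refine Finset.sum_congr rfl fun i _ => ?_
    rw [mulVec_diagonal]
    ring
  · rw [hardThreshold, hf]

lemma dotProduct_self_eq_of_orthogonal {V : Matrix (Fin d₂) (Fin d₂) ℝ} (hV : V * Vᵀ = 1)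
    (v : Fin d₂ → ℝ) : v ⬝ᵥ v = ∑ i, (Vᵀ *ᵥ v) i ^ 2 := by
  have : (Vᵀ *ᵥ v) ⬝ᵥ (Vᵀ *ᵥ v) = v ⬝ᵥ v := by
    rw [dotProduct_mulVec, ← mulVec_transpose, transpose_transpose, mulVec_mulVec, hV,
      one_mulVec]
  rw [← this, dotProduct]
  exact Finset.sum_congr rfl fun i _ => by ring

lemma opNorm_hardThreshold_sub_le {τ : ℝ} (hτ : 0 ≤ τ) (M : Matrix (Fin d₁) (Fin d₂) ℝ) :
    opNorm (hardThreshold τ M - M) ≤ τ := by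
  obtain ⟨V, a, h1, h2, ha, hM, ht⟩ := exists_right_svd τ M
  refine opNorm_le_of_mulVec _ hτ fun v => ?_
  set e : Fin d₂ → ℝ := fun i => if τ < Real.sqrt (a i) then (1 : ℝ) else 0 with he
  have e1 : (hardThreshold τ M - M) *ᵥ v = M *ᵥ (V *ᵥ (fun i => (e i - 1) * (Vᵀ *ᵥ v) i)) := by
    have : (fun i => (e i - 1) * (Vᵀ *ᵥ v) i) = diagonal e *ᵥ (Vᵀ *ᵥ v) - Vᵀ *ᵥ v := by
      ext i
      rw [Pi.sub_apply, mulVec_diagonal, sub_mul, one_mul]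
    rw [this, mulVec_sub, mulVec_mulVec, mulVec_mulVec, mulVec_mulVec, h2, one_mulVec, mulVec_sub,
      sub_mulVec, ht, mulVec_mulVec]
  rw [e1, hM, mulVec_mulVec, h1, one_mulVec, dotProduct_self_eq_of_orthogonal h2, Finset.mul_sum]
  refine Finset.sum_le_sum fun i _ => ?_
  simp only [he]
  split_ifs with hi
  · simp only [sub_self, zero_mul]
    rw [zero_pow two_ne_zero, mul_zero]
    positivity
  · have : a i ≤ τ ^ 2 := by
      rw [← Real.sq_sqrt (ha i)]
      exact pow_le_pow_left₀ (Real.sqrt_nonneg _) (not_lt.1 hi) 2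
    nlinarith [mul_le_mul_of_nonneg_right this (sq_nonneg ((Vᵀ *ᵥ v) i))]

/-- If `M` is `τ`-close to `Θ`, then at most `rank Θ` singular values of `M` exceed `τ`: a vector in
the span of the corresponding right singular vectors that is annihilated by `Θ` is zero. -/
lemma rank_hardThreshold_le {τ : ℝ} (hτ : 0 ≤ τ) {M Θ : Matrix (Fin d₁) (Fin d₂) ℝ}
    (h : opNorm (M - Θ) ≤ τ) : (hardThreshold τ M).rank ≤ Θ.rank := by
  obtain ⟨V, a, h1, h2, ha, hM, ht⟩ := exists_right_svd τ M
  set e : Fin d₂ → ℝ := fun i => if τ < Real.sqrt (a i) then (1 : ℝ) else 0 with he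
  rw [ht]
  refine (rank_mul_le_right _ _).trans ?_
  set P := V * diagonal e * Vᵀ with hP
  have hinj : LinearMap.range P.mulVecLin ⊓ LinearMap.ker Θ.mulVecLin = ⊥ := by
    rw [eq_bot_iff]
    rintro v ⟨⟨w, hw⟩, hv⟩
    have hv0 : Θ *ᵥ v = 0 := hv
    have hcoord : ∀ i, (Vᵀ *ᵥ v) i = e i * (Vᵀ *ᵥ w) i := fun i => by
      have : v = P *ᵥ w := hw.symm
      rw [this, hP, mulVec_mulVec]
      have e2 : Vᵀ * (V * diagonal e * Vᵀ) = diagonal e * Vᵀ := by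
        simp only [← Matrix.mul_assoc]
        rw [h1, Matrix.one_mul]
      rw [e2, ← mulVec_mulVec, mulVec_diagonal]
    have hle : (M *ᵥ v) ⬝ᵥ (M *ᵥ v) ≤ τ ^ 2 * (v ⬝ᵥ v) := by
      have h3 : M *ᵥ v = (M - Θ) *ᵥ v := by rw [sub_mulVec, hv0, sub_zero]
      rw [h3]
      refine (opNorm_mulVec_le _ _).trans (mul_le_mul_of_nonneg_right
        (pow_le_pow_left₀ (opNorm_nonneg _) h 2) ?_)
      exact dotProduct_self_eq_of_orthogonal h2 v ▸ Finset.sum_nonneg fun i _ => sq_nonneg _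
    rw [hM, dotProduct_self_eq_of_orthogonal h2, Finset.mul_sum] at hle
    have hterm : ∀ i ∈ Finset.univ, τ ^ 2 * (Vᵀ *ᵥ v) i ^ 2 ≤ a i * (Vᵀ *ᵥ v) i ^ 2 := by
      intro i _
      rw [hcoord i]
      simp only [he]
      split_ifs with hi
      · refine mul_le_mul_of_nonneg_right ?_ (sq_nonneg _)
        exact ((Real.lt_sqrt hτ).1 hi).le
      · simp
    have heq := (Finset.sum_eq_sum_iff_of_le hterm).1 (le_antisymm (Finset.sum_le_sum hterm) hle)
    have hz : Vᵀ *ᵥ v = 0 := by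
      ext i
      by_contra hne
      have hi : τ < Real.sqrt (a i) := by
        by_contra hi
        exact hne (by rw [hcoord i]; simp [he, hi])
      have := mul_right_cancel₀ (pow_ne_zero 2 hne) (heq i (Finset.mem_univ i))
      exact ((Real.lt_sqrt hτ).1 hi).ne this
    have : v = V *ᵥ (Vᵀ *ᵥ v) := by rw [mulVec_mulVec, h2, one_mulVec]
    rw [Submodule.mem_bot, this, hz, mulVec_zero]
  have hdim := Submodule.finrank_add_finrank_le_of_disjoint (disjoint_iff.2 hinj)
  have hker := LinearMap.finrank_range_add_finrank_ker Θ.mulVecLin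
  rw [Matrix.rank, Matrix.rank]
  omega

lemma opNorm_hardThreshold_sub_le_two_mul {τ : ℝ} (hτ : 0 ≤ τ) {M Θ : Matrix (Fin d₁) (Fin d₂) ℝ}
    (h : opNorm (M - Θ) ≤ τ) : opNorm (hardThreshold τ M - Θ) ≤ 2 * τ := by
  have h1 := opNorm_add_le (hardThreshold τ M - M) (M - Θ)
  rw [sub_add_sub_cancel] at h1
  linarith [opNorm_hardThreshold_sub_le hτ M]

/-! ### Symmetric dilations -/

lemma isHermitian_dilation (A : Matrix (Fin d₁) (Fin d₂) ℝ) : (dilation A).IsHermitian := by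
  rw [IsHermitian, conjTranspose_eq_transpose_of_trivial, dilation, fromBlocks_transpose]
  simp

/-- The reflection `diag(1, -1)`, which anticommutes with every dilation. -/
def reflection (d₁ d₂ : ℕ) : Matrix (Fin d₁ ⊕ Fin d₂) (Fin d₁ ⊕ Fin d₂) ℝ :=
  fromBlocks 1 0 0 (-1)

lemma reflection_mul_self : reflection d₁ d₂ * reflection d₁ d₂ = 1 := by
  simp [reflection, fromBlocks_multiply]

lemma reflection_mul_dilation (A : Matrix (Fin d₁) (Fin d₂) ℝ) :
    reflection d₁ d₂ * dilation A * reflection d₁ d₂ = -dilation A := by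
  simp [reflection, dilation, fromBlocks_multiply, fromBlocks_neg]

/-- An odd function of a dilation has vanishing diagonal blocks: conjugation with the reflection
`diag(1, -1)` turns it into its negative. -/
lemma cfc_catoni_dilation (ν : ℝ) (A : Matrix (Fin d₁) (Fin d₂) ℝ) :
    reflection d₁ d₂ * cfc catoni (ν • dilation A) * reflection d₁ d₂ =
      -cfc catoni (ν • dilation A) := by
  set Z := ν • dilation A with hZ
  have hZh : IsSelfAdjoint Z := (isHermitian_dilation A).smul (IsSelfAdjoint.all ν)
  have hJ : star (reflection d₁ d₂) = reflection d₁ d₂ := by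
    rw [star_eq_conjTranspose, conjTranspose_eq_transpose_of_trivial, reflection,
      fromBlocks_transpose]
    simp
  have hJu : reflection d₁ d₂ ∈ unitary (Matrix (Fin d₁ ⊕ Fin d₂) (Fin d₁ ⊕ Fin d₂) ℝ) :=
    ⟨by rw [hJ, reflection_mul_self], by rw [hJ, reflection_mul_self]⟩
  let u : unitary (Matrix (Fin d₁ ⊕ Fin d₂) (Fin d₁ ⊕ Fin d₂) ℝ) := ⟨_, hJu⟩
  have hconj : ∀ X, Unitary.conjStarAlgAut ℝ _ u X = reflection d₁ d₂ * X * reflection d₁ d₂ := by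
    intro X
    rw [Unitary.conjStarAlgAut_apply]
    simp [u, hJ]
  have hZneg : Unitary.conjStarAlgAut ℝ _ u Z = -Z := by
    rw [hconj, hZ, Matrix.mul_smul, Matrix.smul_mul, reflection_mul_dilation, smul_neg]
  have hcont : Continuous (Unitary.conjStarAlgAut ℝ _ u) := by
    have : (Unitary.conjStarAlgAut ℝ _ u : _ → _) =
        fun X => reflection d₁ d₂ * X * reflection d₁ d₂ := funext hconj
    rw [this]
    fun_prop
  rw [← hconj, StarAlgHomClass.map_cfc (Unitary.conjStarAlgAut ℝ _ u) catoni Z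
    continuous_catoni.continuousOn hcont hZh (by rw [hZneg]; exact hZh.neg), hZneg,
    ← cfc_comp_neg catoni Z continuous_catoni.continuousOn hZh]
  simp only [catoni_neg]
  exact cfc_neg (fun x => catoni x) Z

/-- A symmetric matrix with vanishing diagonal blocks and numerical range bounded by `c` has an
off-diagonal block of operator norm at most `c`. -/
lemma opNorm_toBlocks₁₂_le {G : Matrix (Fin d₁ ⊕ Fin d₂) (Fin d₁ ⊕ Fin d₂) ℝ}
    (hG : G.IsHermitian) (hodd : reflection d₁ d₂ * G * reflection d₁ d₂ = -G) {c : ℝ}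
    (hc : 0 < c) (h : ∀ w, w ⬝ᵥ (G *ᵥ w) ≤ c * (w ⬝ᵥ w)) : opNorm G.toBlocks₁₂ ≤ c := by
  obtain ⟨A, B, C, D, rfl⟩ : ∃ A B C D, G = fromBlocks A B C D :=
    ⟨_, _, _, _, (fromBlocks_toBlocks G).symm⟩
  rw [reflection, fromBlocks_multiply, fromBlocks_multiply, fromBlocks_neg, fromBlocks_inj] at hodd
  simp only [Matrix.one_mul, Matrix.zero_mul, Matrix.mul_one, Matrix.mul_zero, add_zero,
    zero_add, Matrix.neg_mul, Matrix.mul_neg, neg_neg] at hodd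
  obtain ⟨hA, -, -, hD⟩ := hodd
  replace hA : A = 0 := by
    ext i j
    have := congrFun (congrFun hA i) j
    rw [Matrix.neg_apply] at this
    simpa using self_eq_neg.1 this
  replace hD : D = 0 := by
    ext i j
    have := congrFun (congrFun hD i) j
    rw [Matrix.neg_apply] at this
    simpa using self_eq_neg.1 this
  rw [IsHermitian, conjTranspose_eq_transpose_of_trivial, fromBlocks_transpose,
    fromBlocks_inj] at hG
  obtain ⟨-, rfl, -, -⟩ := hG
  subst hA hD
  rw [toBlocks_fromBlocks₁₂]
  refine opNorm_le_of_mulVec _ hc.le fun v => ?_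
  -- The test vector `(Cᵀ v, c v)`: its two components have comparable norms.
  have h1 := h (Sum.elim (Cᵀ *ᵥ v) (c • v))
  rw [fromBlocks_mulVec, sumElim_dotProduct_sumElim, sumElim_dotProduct_sumElim] at h1
  simp only [Sum.elim_comp_inl, Sum.elim_comp_inr, zero_mulVec, zero_add, add_zero, mulVec_smul,
    smul_zero, dotProduct_smul, smul_dotProduct, smul_eq_mul] at h1
  have h2 : v ⬝ᵥ (C *ᵥ (Cᵀ *ᵥ v)) = (Cᵀ *ᵥ v) ⬝ᵥ (Cᵀ *ᵥ v) := by
    rw [dotProduct_mulVec, ← mulVec_transpose]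
  rw [h2] at h1
  refine le_of_mul_le_mul_left ?_ hc
  linarith
end Deterministic

/-! ### Moments of the one-sample estimate -/

section Noise

variable {Ω E : Type*} {mΩ : MeasurableSpace Ω} [MeasurableSpace E] {μ : Measure Ω}
  [IsProbabilityMeasure μ] {X : Ω → E} {η : Ω → ℝ}

lemma integral_comp_mul_noise_eq_zero (hX : Measurable X) (hη₂ : MemLp η 2 μ)
    (hmean : μ[η | MeasurableSpace.comap X inferInstance] =ᵐ[μ] 0) {f : E → ℝ}
    (hf : Measurable f) (hint : Integrable (fun ω => f (X ω) * η ω) μ) :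
    ∫ ω, f (X ω) * η ω ∂μ = 0 := by
  have hm : MeasurableSpace.comap X inferInstance ≤ mΩ := hX.comap_le
  have hfm : StronglyMeasurable[MeasurableSpace.comap X inferInstance] (fun ω => f (X ω)) :=
    (hf.comp (comap_measurable X)).stronglyMeasurable
  have h := condExp_mul_of_stronglyMeasurable_left (μ := μ) hfm hint
    (hη₂.integrable one_le_two)
  rw [← integral_condExp hm]
  refine integral_eq_zero_of_ae ?_
  refine Filter.EventuallyEq.trans h ?_
  filter_upwards [hmean] with ω hω
  simp [hω]

/-- The conditional second moment bound, tested against nonnegative functions of `X` without any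
integrability assumption. -/
lemma lintegral_sq_noise_mul_le (hX : Measurable X) (hη : Measurable η) (hη₂ : MemLp η 2 μ)
    {σ : ℝ} (hvar : μ[fun ω => η ω ^ 2 | MeasurableSpace.comap X inferInstance]
      ≤ᵐ[μ] fun _ => σ ^ 2) {f : E → ENNReal} (hf : Measurable f) :
    ∫⁻ ω, ENNReal.ofReal (η ω ^ 2) * f (X ω) ∂μ ≤
      ENNReal.ofReal (σ ^ 2) * ∫⁻ x, f x ∂(μ.map X) := by
  have hm : MeasurableSpace.comap X inferInstance ≤ mΩ := hX.comap_le
  have hηm : Measurable fun ω => ENNReal.ofReal (η ω ^ 2) := (hη.pow_const 2).ennreal_ofReal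
  have hle : (μ.withDensity fun ω => ENNReal.ofReal (η ω ^ 2)).map X ≤
      ENNReal.ofReal (σ ^ 2) • μ.map X := by
    refine Measure.le_iff.2 fun s hs => ?_
    rw [Measure.map_apply hX hs, withDensity_apply _ (hX hs), Measure.smul_apply,
      Measure.map_apply hX hs, smul_eq_mul,
      ← ofReal_integral_eq_lintegral_ofReal hη₂.integrable_sq.integrableOn
        (Filter.Eventually.of_forall fun ω => sq_nonneg _),
      ← setIntegral_condExp hm hη₂.integrable_sq ⟨s, hs, rfl⟩]
    have h1 : ∫ ω in X ⁻¹' s, (μ[fun ω => η ω ^ 2 | MeasurableSpace.comap X inferInstance]) ω ∂μ ≤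
        ∫ _ in X ⁻¹' s, σ ^ 2 ∂μ :=
      setIntegral_mono_ae integrable_condExp.integrableOn (integrable_const _).integrableOn hvar
    refine (ENNReal.ofReal_le_ofReal h1).trans_eq ?_
    rw [setIntegral_const, smul_eq_mul, mul_comm, ENNReal.ofReal_mul (sq_nonneg _),
      ofReal_measureReal]
  calc ∫⁻ ω, ENNReal.ofReal (η ω ^ 2) * f (X ω) ∂μ
      = ∫⁻ x, f x ∂((μ.withDensity fun ω => ENNReal.ofReal (η ω ^ 2)).map X) := by
        exact ((lintegral_map hf hX).trans
          (lintegral_withDensity_eq_lintegral_mul _ hηm (hf.comp hX))).symm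
    _ ≤ ∫⁻ x, f x ∂(ENNReal.ofReal (σ ^ 2) • μ.map X) := lintegral_mono' hle le_rfl
    _ = _ := by rw [lintegral_smul_measure, smul_eq_mul]

/-- For a design variable `ℓ` and a bounded signal `D`, both functions of `X`, the second moment of
`(D + η) ℓ` is at most `σ² + R²` times that of `ℓ`. -/
lemma integral_sq_mul_sq_le (hX : Measurable X) (hη : Measurable η) (hη₂ : MemLp η 2 μ)
    (hmean : μ[η | MeasurableSpace.comap X inferInstance] =ᵐ[μ] 0)
    {σ R : ℝ} (hvar : μ[fun ω => η ω ^ 2 | MeasurableSpace.comap X inferInstance]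
      ≤ᵐ[μ] fun _ => σ ^ 2) {D ℓ : E → ℝ} (hD : Measurable D) (hℓ : Measurable ℓ)
    (hDR : ∀ᵐ ω ∂μ, |D (X ω)| ≤ R) (hℓ₂ : MemLp ℓ 2 (μ.map X)) :
    Integrable (fun ω => (D (X ω) + η ω) ^ 2 * ℓ (X ω) ^ 2) μ ∧
    ∫ ω, (D (X ω) + η ω) ^ 2 * ℓ (X ω) ^ 2 ∂μ ≤
      (σ ^ 2 + R ^ 2) * ∫ x, ℓ x ^ 2 ∂(μ.map X) := by
  have hℓi : Integrable (fun ω => ℓ (X ω) ^ 2) μ :=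
    (integrable_map_measure hℓ₂.integrable_sq.aestronglyMeasurable hX.aemeasurable).1
      hℓ₂.integrable_sq
  have hℓe : ∫ x, ℓ x ^ 2 ∂(μ.map X) = ∫ ω, ℓ (X ω) ^ 2 ∂μ :=
    integral_map hX.aemeasurable hℓ₂.integrable_sq.aestronglyMeasurable
  have hlin : ∫⁻ ω, ENNReal.ofReal (η ω ^ 2 * ℓ (X ω) ^ 2) ∂μ ≤
      ENNReal.ofReal (σ ^ 2 * ∫ ω, ℓ (X ω) ^ 2 ∂μ) := by
    have h := lintegral_sq_noise_mul_le hX hη hη₂ hvar (f := fun x => ENNReal.ofReal (ℓ x ^ 2))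
      (hℓ.pow_const 2).ennreal_ofReal
    rw [← ofReal_integral_eq_lintegral_ofReal hℓ₂.integrable_sq
      (Filter.Eventually.of_forall fun _ => sq_nonneg _), hℓe,
      ← ENNReal.ofReal_mul (sq_nonneg _)] at h
    simpa only [ENNReal.ofReal_mul (sq_nonneg (η _))] using h
  have hηℓ : Integrable (fun ω => η ω ^ 2 * ℓ (X ω) ^ 2) μ := by
    refine ⟨by fun_prop, ?_⟩
    rw [hasFiniteIntegral_iff_ofReal (Filter.Eventually.of_forall fun _ => by positivity)]
    exact hlin.trans_lt ENNReal.ofReal_lt_top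
  have hηℓ_le : ∫ ω, η ω ^ 2 * ℓ (X ω) ^ 2 ∂μ ≤ σ ^ 2 * ∫ ω, ℓ (X ω) ^ 2 ∂μ := by
    rw [← ofReal_integral_eq_lintegral_ofReal hηℓ
      (Filter.Eventually.of_forall fun _ => by positivity)] at hlin
    exact (ENNReal.ofReal_le_ofReal_iff
      (mul_nonneg (sq_nonneg _) (integral_nonneg fun _ => sq_nonneg _))).1 hlin
  have hDℓ : Integrable (fun ω => D (X ω) ^ 2 * ℓ (X ω) ^ 2) μ := by
    refine (hℓi.const_mul (R ^ 2)).mono' (by fun_prop) ?_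
    filter_upwards [hDR] with ω hω
    rw [Real.norm_of_nonneg (by positivity)]
    exact mul_le_mul_of_nonneg_right (sq_le_sq' (abs_le.1 hω).1 (abs_le.1 hω).2) (sq_nonneg _)
  -- The cross term is integrable since `2 |D η| ≤ D² + η²`.
  have hcross : Integrable (fun ω => (D (X ω) * ℓ (X ω) ^ 2) * η ω) μ := by
    refine (hDℓ.add hηℓ).mono' (by fun_prop) (Filter.Eventually.of_forall fun ω => ?_)
    simp only [Pi.add_apply, Real.norm_eq_abs]
    rw [abs_le]
    have := sq_nonneg (ℓ (X ω))
    constructor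
    · nlinarith [mul_nonneg this (sq_nonneg (D (X ω) + η ω)),
        mul_nonneg this (sq_nonneg (D (X ω))), mul_nonneg this (sq_nonneg (η ω))]
    · nlinarith [mul_nonneg this (sq_nonneg (D (X ω) - η ω)),
        mul_nonneg this (sq_nonneg (D (X ω))), mul_nonneg this (sq_nonneg (η ω))]
  have hzero : ∫ ω, (D (X ω) * ℓ (X ω) ^ 2) * η ω ∂μ = 0 :=
    integral_comp_mul_noise_eq_zero hX hη₂ hmean (f := fun x => D x * ℓ x ^ 2)
      (hD.mul (hℓ.pow_const 2)) hcross
  have e : (fun ω => (D (X ω) + η ω) ^ 2 * ℓ (X ω) ^ 2) = fun ω =>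
      (D (X ω) ^ 2 * ℓ (X ω) ^ 2 + 2 * ((D (X ω) * ℓ (X ω) ^ 2) * η ω)) +
        η ω ^ 2 * ℓ (X ω) ^ 2 := by
    ext ω
    ring
  have hDℓ_le : ∫ ω, D (X ω) ^ 2 * ℓ (X ω) ^ 2 ∂μ ≤ R ^ 2 * ∫ ω, ℓ (X ω) ^ 2 ∂μ := by
    rw [← integral_const_mul]
    refine integral_mono_ae hDℓ (hℓi.const_mul _) ?_
    filter_upwards [hDR] with ω hω
    exact mul_le_mul_of_nonneg_right (sq_le_sq' (abs_le.1 hω).1 (abs_le.1 hω).2) (sq_nonneg _)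
  rw [e]
  refine ⟨(hDℓ.add (hcross.const_mul 2)).add hηℓ, ?_⟩
  have hsplit : ∫ ω, ((D (X ω) ^ 2 * ℓ (X ω) ^ 2 + 2 * ((D (X ω) * ℓ (X ω) ^ 2) * η ω)) +
      η ω ^ 2 * ℓ (X ω) ^ 2) ∂μ = ∫ ω, D (X ω) ^ 2 * ℓ (X ω) ^ 2 ∂μ +
        ∫ ω, η ω ^ 2 * ℓ (X ω) ^ 2 ∂μ := by
    refine (integral_add (hDℓ.add (hcross.const_mul 2)) hηℓ).trans ?_
    congr 1
    refine (integral_add hDℓ (hcross.const_mul 2)).trans ?_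
    rw [integral_const_mul, hzero, mul_zero, add_zero]
  rw [hsplit, hℓe]
  linarith

end Noise

section Design

variable {d₁ d₂ : ℕ} {π : Measure (Matrix (Fin d₁) (Fin d₂) ℝ)}

lemma ip_eq_dotProduct (A C : Matrix (Fin d₁) (Fin d₂) ℝ) : ip A C = vec A ⬝ᵥ vec C := by
  rw [ip, vec_dotProduct_vec]

lemma measurable_dotProduct_vec (c : Fin d₂ × Fin d₁ → ℝ) :
    Measurable fun A : Matrix (Fin d₁) (Fin d₂) ℝ => c ⬝ᵥ vec A := by
  refine Finset.measurable_fun_sum _ fun p _ => ?_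
  exact (measurable_entry p.2 p.1).const_mul (c p)

lemma memLp_dotProduct_vec
    (hπ₂ : ∀ k i, MemLp (fun A : Matrix (Fin d₁) (Fin d₂) ℝ => A k i) 2 π)
    (c : Fin d₂ × Fin d₁ → ℝ) : MemLp (fun A => c ⬝ᵥ vec A) 2 π :=
  memLp_finsetSum _ fun p _ => (hπ₂ p.2 p.1).const_mul (c p)

lemma integral_dotProduct_mul_dotProduct
    (hπ₂ : ∀ k i, MemLp (fun A : Matrix (Fin d₁) (Fin d₂) ℝ => A k i) 2 π)
    (c e : Fin d₂ × Fin d₁ → ℝ) :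
    ∫ A, (c ⬝ᵥ vec A) * (e ⬝ᵥ vec A) ∂π = c ⬝ᵥ (covMatrix π *ᵥ e) := by
  have hi : ∀ p q : Fin d₂ × Fin d₁,
      Integrable (fun A : Matrix (Fin d₁) (Fin d₂) ℝ => c p * (vec A p * vec A q * e q)) π :=
    fun p q => (((hπ₂ p.2 p.1).integrable_mul (hπ₂ q.2 q.1)).mul_const _).const_mul _
  have e1 : ∀ A : Matrix (Fin d₁) (Fin d₂) ℝ, (c ⬝ᵥ vec A) * (e ⬝ᵥ vec A) =
      ∑ p, ∑ q, c p * (vec A p * vec A q * e q) := by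
    intro A
    simp only [dotProduct]
    rw [Finset.sum_mul_sum]
    refine Finset.sum_congr rfl fun p _ => Finset.sum_congr rfl fun q _ => ?_
    ring
  simp only [e1]
  rw [integral_finsetSum _ fun p _ => integrable_finsetSum _ fun q _ => hi p q, dotProduct]
  refine Finset.sum_congr rfl fun p _ => ?_
  rw [integral_finsetSum _ fun q _ => hi p q, mulVec, dotProduct, Finset.mul_sum]
  refine Finset.sum_congr rfl fun q _ => ?_
  rw [integral_const_mul, integral_mul_const]
  rfl

lemma covMatrix_isHermitian : (covMatrix π).IsHermitian := by
  ext p q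
  simp [covMatrix, mul_comm]

lemma covMatrix_posDef
    (hπ₂ : ∀ k i, MemLp (fun A : Matrix (Fin d₁) (Fin d₂) ℝ => A k i) 2 π)
    (hQ : IsUnit (covMatrix π).det) : (covMatrix π).PosDef := by
  have h : (covMatrix π).PosSemidef := by
    refine PosSemidef.of_dotProduct_mulVec_nonneg covMatrix_isHermitian fun x => ?_
    rw [star_trivial, ← integral_dotProduct_mul_dotProduct hπ₂]
    exact integral_nonneg fun A => mul_self_nonneg _
  exact h.posDef_iff_isUnit.2 ((isUnit_iff_isUnit_det _).2 hQ)

lemma dotProduct_mulVec_le_lambdaMax {n : ℕ} {A : Matrix (Fin n) (Fin n) ℝ} (hA : A.IsHermitian)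
    (x : Fin n → ℝ) : x ⬝ᵥ (A *ᵥ x) ≤ lambdaMax A * (x ⬝ᵥ x) := by
  have hA' : IsSelfAdjoint A := hA
  have hbdd : BddAbove (spectrum ℝ A) := (Matrix.finite_real_spectrum (A := A)).bddAbove
  have h : (lambdaMax A • (1 : Matrix (Fin n) (Fin n) ℝ) - A).PosSemidef := by
    have := posSemidef_cfc_sub_cfc hA (f := fun x => x) (g := fun _ => lambdaMax A)
      fun x hx => le_csSup hbdd hx
    rwa [cfc_id' ℝ A, cfc_const (R := ℝ) (lambdaMax A) A, Algebra.algebraMap_eq_smul_one] at this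
  have := h.dotProduct_mulVec_nonneg x
  rw [star_trivial, sub_mulVec, smul_mulVec, one_mulVec, dotProduct_sub, dotProduct_smul,
    smul_eq_mul] at this
  linarith

variable {Q : Matrix (Fin d₂ × Fin d₁) (Fin d₂ × Fin d₁) ℝ}

/-- The coefficient vector supported on the column `i`, with the values `u` there. -/
def colVec (i : Fin d₂) (u : Fin d₁ → ℝ) : Fin d₂ × Fin d₁ → ℝ :=
  fun p => if p.1 = i then u p.2 else 0

/-- The coefficient vector supported on the row `k`, with the values `u` there. -/
def rowVec (k : Fin d₁) (u : Fin d₂ → ℝ) : Fin d₂ × Fin d₁ → ℝ :=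
  fun p => if p.2 = k then u p.1 else 0

lemma colVec_dotProduct (i : Fin d₂) (u : Fin d₁ → ℝ) (x : Fin d₂ × Fin d₁ → ℝ) :
    colVec i u ⬝ᵥ x = ∑ k, u k * x (i, k) := by
  simp only [dotProduct, colVec, Fintype.sum_prod_type, ite_mul, zero_mul]
  rw [Finset.sum_eq_single i]
  · simp
  · intro j _ hj
    simp [hj]
  · simp

lemma rowVec_dotProduct (k : Fin d₁) (u : Fin d₂ → ℝ) (x : Fin d₂ × Fin d₁ → ℝ) :
    rowVec k u ⬝ᵥ x = ∑ i, u i * x (i, k) := by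
  simp [dotProduct, rowVec, Fintype.sum_prod_type, ite_mul]

lemma sum_colVec_le (hQ : Q.IsHermitian) (u : Fin d₁ → ℝ) :
    ∑ i, colVec i u ⬝ᵥ (Q⁻¹ *ᵥ colVec i u) ≤ B Q * (u ⬝ᵥ u) := by
  have hsym : ∀ p q, Q⁻¹ p q = Q⁻¹ q p := fun p q => by
    simpa using congrFun (congrFun hQ.inv q) p
  have hH : (∑ i, colBlock Q i).IsHermitian := by
    ext k l
    simp [Matrix.sum_apply, colBlock, hsym (_, l)]
  have e : ∑ i, colVec i u ⬝ᵥ (Q⁻¹ *ᵥ colVec i u) = u ⬝ᵥ ((∑ i, colBlock Q i) *ᵥ u) := by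
    rw [sum_mulVec, dotProduct_sum]
    refine Finset.sum_congr rfl fun i _ => ?_
    rw [colVec_dotProduct, dotProduct]
    refine Finset.sum_congr rfl fun k _ => ?_
    rw [mulVec, mulVec, dotProduct_comm, colVec_dotProduct, dotProduct_comm]
    rfl
  rw [e]
  refine (dotProduct_mulVec_le_lambdaMax hH u).trans (mul_le_mul_of_nonneg_right
    (le_max_left _ _) ?_)
  exact Finset.sum_nonneg fun i _ => mul_self_nonneg _

lemma sum_rowVec_le (hQ : Q.IsHermitian) (u : Fin d₂ → ℝ) :
    ∑ k, rowVec k u ⬝ᵥ (Q⁻¹ *ᵥ rowVec k u) ≤ B Q * (u ⬝ᵥ u) := by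
  have hsym : ∀ p q, Q⁻¹ p q = Q⁻¹ q p := fun p q => by
    simpa using congrFun (congrFun hQ.inv q) p
  have hH : (∑ k, rowBlock Q k).IsHermitian := by
    ext i j
    simp [Matrix.sum_apply, rowBlock, hsym (j, _)]
  have e : ∑ k, rowVec k u ⬝ᵥ (Q⁻¹ *ᵥ rowVec k u) = u ⬝ᵥ ((∑ k, rowBlock Q k) *ᵥ u) := by
    rw [sum_mulVec, dotProduct_sum]
    refine Finset.sum_congr rfl fun k _ => ?_
    rw [rowVec_dotProduct, dotProduct]
    refine Finset.sum_congr rfl fun i _ => ?_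
    rw [mulVec, mulVec, dotProduct_comm, rowVec_dotProduct, dotProduct_comm]
    rfl
  rw [e]
  refine (dotProduct_mulVec_le_lambdaMax hH u).trans (mul_le_mul_of_nonneg_right
    (le_max_right _ _) ?_)
  exact Finset.sum_nonneg fun i _ => mul_self_nonneg _

lemma B_pos (hQ : Q.PosDef) (h₁ : 0 < d₁) (h₂ : 0 < d₂) : 0 < B Q := by
  have h := sum_colVec_le hQ.isHermitian (Pi.single ⟨0, h₁⟩ 1)
  simp only [single_one_dotProduct, Pi.single_eq_same, mul_one] at h
  -- `h` bounds the sum of the diagonal entries `(i, 0)` of `Q⁻¹` by `B Q`.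
  refine lt_of_lt_of_le (Finset.sum_pos (fun i _ => ?_) ⟨⟨0, h₂⟩, Finset.mem_univ _⟩) h
  have := hQ.inv.dotProduct_mulVec_pos (x := colVec i (Pi.single (⟨0, h₁⟩ : Fin d₁) 1)) ?_
  · simpa using this
  · intro h0
    have := congrFun h0 (i, ⟨0, h₁⟩)
    simp [colVec] at this

end Design

lemma dotProduct_integral_mulVec {Ω n : Type*} [MeasurableSpace Ω] {μ : Measure Ω} [Fintype n]
    {A : Ω → Matrix n n ℝ}
    (hA : ∀ i j, Integrable (fun ω => A ω i j) μ) (x : n → ℝ) :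
    x ⬝ᵥ ((Matrix.of fun i j => ∫ ω, A ω i j ∂μ) *ᵥ x) = ∫ ω, x ⬝ᵥ (A ω *ᵥ x) ∂μ := by
  simp only [dotProduct, mulVec, of_apply, Finset.mul_sum]
  have hi : ∀ i j, Integrable (fun ω => x i * (A ω i j * x j)) μ := fun i j =>
    ((hA i j).mul_const _).const_mul _
  rw [integral_finsetSum _ fun i _ => integrable_finsetSum _ fun j _ => hi i j]
  refine Finset.sum_congr rfl fun i _ => ?_
  rw [integral_finsetSum _ fun j _ => hi i j]
  refine Finset.sum_congr rfl fun j _ => ?_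
  rw [integral_const_mul, integral_mul_const]

section OneSample

variable {d₁ d₂ : ℕ} {π : Measure (Matrix (Fin d₁) (Fin d₂) ℝ)}
  {Ω : Type*} {mΩ : MeasurableSpace Ω} {μ : Measure Ω} [IsProbabilityMeasure μ]
  {X : Ω → Matrix (Fin d₁) (Fin d₂) ℝ} {η : Ω → ℝ}

lemma dotProduct_inv_mulVec {Q : Matrix (Fin d₂ × Fin d₁) (Fin d₂ × Fin d₁) ℝ}
    (hQ : Q.IsHermitian) (u x : Fin d₂ × Fin d₁ → ℝ) :
    u ⬝ᵥ (Q⁻¹ *ᵥ x) = (Q⁻¹ *ᵥ u) ⬝ᵥ x := by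
  have h : Q⁻¹ᵀ = Q⁻¹ := by
    simpa [IsHermitian, conjTranspose_eq_transpose_of_trivial] using hQ.inv
  rw [dotProduct_mulVec, ← mulVec_transpose, h]

/-- First and second moments of a linear functional `u` of the one-sample estimate of `Δ`. -/
lemma moments_functional
    (hπ₂ : ∀ k i, MemLp (fun A : Matrix (Fin d₁) (Fin d₂) ℝ => A k i) 2 π)
    (hQ : IsUnit (covMatrix π).det) (hX : Measurable X) (hη : Measurable η) (hlaw : μ.map X = π)
    (hη₂ : MemLp η 2 μ)
    (hmean : μ[η | MeasurableSpace.comap X inferInstance] =ᵐ[μ] 0) {σ R : ℝ}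
    (hvar : μ[fun ω => η ω ^ 2 | MeasurableSpace.comap X inferInstance] ≤ᵐ[μ] fun _ => σ ^ 2)
    (Δ : Matrix (Fin d₁) (Fin d₂) ℝ) (hR : ∀ᵐ ω ∂μ, |vec Δ ⬝ᵥ vec (X ω)| ≤ R)
    (u : Fin d₂ × Fin d₁ → ℝ) :
    MemLp (fun ω => (vec Δ ⬝ᵥ vec (X ω) + η ω) * (u ⬝ᵥ ((covMatrix π)⁻¹ *ᵥ vec (X ω)))) 2 μ ∧
    ∫ ω, (vec Δ ⬝ᵥ vec (X ω) + η ω) * (u ⬝ᵥ ((covMatrix π)⁻¹ *ᵥ vec (X ω))) ∂μ =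
      u ⬝ᵥ vec Δ ∧
    ∫ ω, ((vec Δ ⬝ᵥ vec (X ω) + η ω) * (u ⬝ᵥ ((covMatrix π)⁻¹ *ᵥ vec (X ω)))) ^ 2 ∂μ ≤
      (σ ^ 2 + R ^ 2) * (u ⬝ᵥ ((covMatrix π)⁻¹ *ᵥ u)) := by
  have hQh : (covMatrix π).IsHermitian := covMatrix_isHermitian
  simp only [dotProduct_inv_mulVec hQh u (vec _)]
  set c := (covMatrix π)⁻¹ *ᵥ u with hc
  have hQc : covMatrix π *ᵥ c = u := by
    rw [hc, mulVec_mulVec, mul_nonsing_inv _ hQ, one_mulVec]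
  have hcm : Measurable fun ω => c ⬝ᵥ vec (X ω) := (measurable_dotProduct_vec c).comp hX
  have hΔm : Measurable fun ω => vec Δ ⬝ᵥ vec (X ω) := (measurable_dotProduct_vec (vec Δ)).comp hX
  have hL : ∀ e : Fin d₂ × Fin d₁ → ℝ, MemLp (fun ω => e ⬝ᵥ vec (X ω)) 2 μ := fun e => by
    have := memLp_dotProduct_vec hπ₂ e
    rw [← hlaw] at this
    exact (memLp_map_measure_iff this.aestronglyMeasurable hX.aemeasurable).1 this
  obtain ⟨h1, h2⟩ := integral_sq_mul_sq_le hX hη hη₂ hmean hvar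
    (measurable_dotProduct_vec (vec Δ)) (measurable_dotProduct_vec c) hR
    (by rw [hlaw]; exact memLp_dotProduct_vec hπ₂ c)
  refine ⟨?_, ?_, ?_⟩
  · refine (memLp_two_iff_integrable_sq ((hΔm.add hη).mul hcm).aestronglyMeasurable).2 ?_
    simpa only [Pi.mul_apply, Pi.add_apply, mul_pow] using h1
  · have hi1 : Integrable (fun ω => (vec Δ ⬝ᵥ vec (X ω)) * (c ⬝ᵥ vec (X ω))) μ :=
      (hL _).integrable_mul (hL _)
    have hi2 : Integrable (fun ω => (c ⬝ᵥ vec (X ω)) * η ω) μ := (hL _).integrable_mul hη₂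
    have e : (fun ω => (vec Δ ⬝ᵥ vec (X ω) + η ω) * (c ⬝ᵥ vec (X ω))) = fun ω =>
        (vec Δ ⬝ᵥ vec (X ω)) * (c ⬝ᵥ vec (X ω)) + (c ⬝ᵥ vec (X ω)) * η ω := by
      ext ω
      ring
    rw [e, integral_add hi1 hi2,
      integral_comp_mul_noise_eq_zero hX hη₂ hmean (measurable_dotProduct_vec c) hi2, add_zero,
      dotProduct_comm u, ← hQc, ← integral_dotProduct_mul_dotProduct hπ₂]
    conv_rhs => rw [← hlaw]
    rw [integral_map hX.aemeasurable]
    exact ((measurable_dotProduct_vec _).mul (measurable_dotProduct_vec _)).aestronglyMeasurable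
  · simp only [mul_pow]
    refine h2.trans_eq ?_
    congr 1
    simp only [pow_two]
    rw [hlaw, integral_dotProduct_mul_dotProduct hπ₂, hQc, dotProduct_comm]

lemma oneSample_mulVec (Q : Matrix (Fin d₂ × Fin d₁) (Fin d₂ × Fin d₁) ℝ)
    (Θ₀ x : Matrix (Fin d₁) (Fin d₂) ℝ) (y : ℝ) (u : Fin d₂ → ℝ) (k : Fin d₁) :
    (oneSample Q Θ₀ x y *ᵥ u) k = (y - ip Θ₀ x) * (rowVec k u ⬝ᵥ (Q⁻¹ *ᵥ vec x)) := by
  rw [rowVec_dotProduct, mulVec, dotProduct, Finset.mul_sum]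
  refine Finset.sum_congr rfl fun i _ => ?_
  rw [oneSample, of_apply]
  ring

lemma oneSample_transpose_mulVec (Q : Matrix (Fin d₂ × Fin d₁) (Fin d₂ × Fin d₁) ℝ)
    (Θ₀ x : Matrix (Fin d₁) (Fin d₂) ℝ) (y : ℝ) (u : Fin d₁ → ℝ) (i : Fin d₂) :
    ((oneSample Q Θ₀ x y)ᵀ *ᵥ u) i = (y - ip Θ₀ x) * (colVec i u ⬝ᵥ (Q⁻¹ *ᵥ vec x)) := by
  rw [colVec_dotProduct, mulVec, dotProduct, Finset.mul_sum]
  refine Finset.sum_congr rfl fun k _ => ?_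
  rw [transpose_apply, oneSample, of_apply]
  ring

/-- Mean and matrix variance of the scaled dilation of the one-sample estimate. The two diagonal
blocks of its square are controlled by the column blocks and the row blocks of `Q⁻¹`. -/
lemma moments_dilation
    (hπ₂ : ∀ k i, MemLp (fun A : Matrix (Fin d₁) (Fin d₂) ℝ => A k i) 2 π)
    (hQ : IsUnit (covMatrix π).det) (hX : Measurable X) (hη : Measurable η) (hlaw : μ.map X = π)
    (hη₂ : MemLp η 2 μ)
    (hmean : μ[η | MeasurableSpace.comap X inferInstance] =ᵐ[μ] 0) {σ R : ℝ}
    (hvar : μ[fun ω => η ω ^ 2 | MeasurableSpace.comap X inferInstance] ≤ᵐ[μ] fun _ => σ ^ 2)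
    (Θ Θ₀ : Matrix (Fin d₁) (Fin d₂) ℝ) (hR : ∀ᵐ ω ∂μ, |ip (Θ₀ - Θ) (X ω)| ≤ R) (ν : ℝ)
    {Z : Ω → Matrix (Fin d₁ ⊕ Fin d₂) (Fin d₁ ⊕ Fin d₂) ℝ}
    (hZ : ∀ ω, Z ω =
      ν • dilation (oneSample (covMatrix π) Θ₀ (X ω) (ip Θ (X ω) + η ω))) :
    (∀ i j, Integrable (fun ω => Z ω i j) μ) ∧
    (∀ i j, Integrable (fun ω => (Z ω * Z ω) i j) μ) ∧
    (∀ i j, ∫ ω, Z ω i j ∂μ = (ν • dilation (Θ - Θ₀)) i j) ∧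
    ((ν ^ 2 * ((σ ^ 2 + R ^ 2) * B (covMatrix π))) •
        (1 : Matrix (Fin d₁ ⊕ Fin d₂) (Fin d₁ ⊕ Fin d₂) ℝ) -
      Matrix.of fun i j => ∫ ω, (Z ω * Z ω) i j ∂μ).PosSemidef := by
  set Q := covMatrix π with hQdef
  have hQh : Q.IsHermitian := covMatrix_isHermitian
  have hres : ∀ ω, ip Θ (X ω) + η ω - ip Θ₀ (X ω) = vec (Θ - Θ₀) ⬝ᵥ vec (X ω) + η ω := by
    intro ω
    rw [ip_eq_dotProduct, ip_eq_dotProduct, vec_sub, sub_dotProduct]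
    ring
  have hR' : ∀ᵐ ω ∂μ, |vec (Θ - Θ₀) ⬝ᵥ vec (X ω)| ≤ R := by
    filter_upwards [hR] with ω hω
    rwa [← neg_sub, vec_neg, neg_dotProduct, abs_neg, ← ip_eq_dotProduct]
  have hmom := moments_functional hπ₂ hQ hX hη hlaw hη₂ hmean hvar (Θ - Θ₀) hR'
  set M : Ω → Matrix (Fin d₁) (Fin d₂) ℝ :=
    fun ω => oneSample Q Θ₀ (X ω) (ip Θ (X ω) + η ω) with hM
  have hrow : ∀ ω k u, (M ω *ᵥ u) k = (vec (Θ - Θ₀) ⬝ᵥ vec (X ω) + η ω) *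
      (rowVec k u ⬝ᵥ (Q⁻¹ *ᵥ vec (X ω))) := fun ω k u => by
    rw [hM, ← hres]; exact oneSample_mulVec _ _ _ _ _ _
  have hcol : ∀ ω i u, ((M ω)ᵀ *ᵥ u) i = (vec (Θ - Θ₀) ⬝ᵥ vec (X ω) + η ω) *
      (colVec i u ⬝ᵥ (Q⁻¹ *ᵥ vec (X ω))) := fun ω i u => by
    rw [hM, ← hres]; exact oneSample_transpose_mulVec _ _ _ _ _ _
  have hentry : ∀ ω k i, M ω k i = (vec (Θ - Θ₀) ⬝ᵥ vec (X ω) + η ω) *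
      (Pi.single (i, k) 1 ⬝ᵥ (Q⁻¹ *ᵥ vec (X ω))) := fun ω k i => by
    rw [hM, ← hres, single_one_dotProduct]; rfl
  have hM₂ : ∀ k i, MemLp (fun ω => M ω k i) 2 μ := fun k i => by
    simp only [hentry]
    exact (hmom (Pi.single (i, k) 1)).1
  have hMmean : ∀ k i, ∫ ω, M ω k i ∂μ = (Θ - Θ₀) k i := fun k i => by
    simp only [hentry]
    rw [(hmom (Pi.single (i, k) 1)).2.1, single_one_dotProduct]
    rfl
  have hZ₂ : ∀ p q, MemLp (fun ω => Z ω p q) 2 μ := by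
    intro p q
    simp only [hZ]
    rcases p with k | i <;> rcases q with l | j
    · simp [dilation]
    · simpa [dilation] using (hM₂ k j).const_mul ν
    · simpa [dilation] using (hM₂ l i).const_mul ν
    · simp [dilation]
  have hZZ : ∀ p q, Integrable (fun ω => (Z ω * Z ω) p q) μ := by
    intro p q
    simp only [Matrix.mul_apply]
    exact integrable_finsetSum _ fun m _ => (hZ₂ p m).integrable_mul (hZ₂ m q)
  refine ⟨fun p q => (hZ₂ p q).integrable one_le_two, hZZ, ?_, ?_⟩
  · intro p q
    simp only [hZ, Matrix.smul_apply, smul_eq_mul, integral_const_mul]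
    congr 1
    rcases p with k | i <;> rcases q with l | j
    · simp [dilation]
    · simpa [dilation] using hMmean k j
    · simpa [dilation] using hMmean l i
    · simp [dilation]
  have hZh : ∀ ω, (Z ω)ᵀ = Z ω := fun ω => by
    have h := isHermitian_dilation (M ω)
    rw [IsHermitian, conjTranspose_eq_transpose_of_trivial] at h
    rw [hZ, transpose_smul, h]
  refine PosSemidef.of_dotProduct_mulVec_nonneg ((isHermitian_smul_one _).sub ?_) fun x => ?_
  · ext p q
    have : ∀ ω, (Z ω * Z ω) q p = (Z ω * Z ω) p q := fun ω => by
      have := congrFun (congrFun (transpose_mul (Z ω) (Z ω)) p) q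
      rwa [hZh] at this
    simp [this]
  rw [star_trivial, sub_mulVec, dotProduct_sub, smul_mulVec, one_mulVec, dotProduct_smul,
    smul_eq_mul, dotProduct_integral_mulVec hZZ, sub_nonneg]
  obtain ⟨x₁, x₂, rfl⟩ : ∃ x₁ x₂, x = Sum.elim x₁ x₂ := ⟨_, _, (Sum.elim_comp_inl_inr x).symm⟩
  have hquad : ∀ ω, Sum.elim x₁ x₂ ⬝ᵥ ((Z ω * Z ω) *ᵥ Sum.elim x₁ x₂) =
      ν ^ 2 * (∑ k, (M ω *ᵥ x₂) k ^ 2 + ∑ i, ((M ω)ᵀ *ᵥ x₁) i ^ 2) := by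
    intro ω
    rw [← mulVec_mulVec, dotProduct_mulVec, ← mulVec_transpose, hZh, hZ, dilation, smul_mulVec,
      fromBlocks_mulVec]
    simp only [Sum.elim_comp_inl, Sum.elim_comp_inr, zero_mulVec, zero_add, add_zero]
    rw [smul_dotProduct, dotProduct_smul, sumElim_dotProduct_sumElim]
    simp only [dotProduct, smul_eq_mul, pow_two, hM]
    ring
  have hi₁ : ∀ k, Integrable (fun ω => (M ω *ᵥ x₂) k ^ 2) μ := fun k => by
    simp only [hrow]
    exact (hmom (rowVec k x₂)).1.integrable_sq
  have hi₂ : ∀ i, Integrable (fun ω => ((M ω)ᵀ *ᵥ x₁) i ^ 2) μ := fun i => by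
    simp only [hcol]
    exact (hmom (colVec i x₁)).1.integrable_sq
  simp only [hquad]
  rw [integral_const_mul, integral_add (integrable_finsetSum _ fun k _ => hi₁ k)
    (integrable_finsetSum _ fun i _ => hi₂ i), integral_finsetSum _ fun k _ => hi₁ k,
    integral_finsetSum _ fun i _ => hi₂ i, sumElim_dotProduct_sumElim]
  have hb₁ : ∑ k, ∫ ω, (M ω *ᵥ x₂) k ^ 2 ∂μ ≤ (σ ^ 2 + R ^ 2) * (B Q * (x₂ ⬝ᵥ x₂)) := by
    refine le_trans ?_ (mul_le_mul_of_nonneg_left (sum_rowVec_le hQh x₂) (by positivity))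
    rw [Finset.mul_sum]
    refine Finset.sum_le_sum fun k _ => ?_
    simp only [hrow]
    exact (hmom (rowVec k x₂)).2.2
  have hb₂ : ∑ i, ∫ ω, ((M ω)ᵀ *ᵥ x₁) i ^ 2 ∂μ ≤ (σ ^ 2 + R ^ 2) * (B Q * (x₁ ⬝ᵥ x₁)) := by
    refine le_trans ?_ (mul_le_mul_of_nonneg_left (sum_colVec_le hQh x₁) (by positivity))
    rw [Finset.mul_sum]
    refine Finset.sum_le_sum fun i _ => ?_
    simp only [hcol]
    exact (hmom (colVec i x₁)).2.2
  calc _ ≤ ν ^ 2 * ((σ ^ 2 + R ^ 2) * (B Q * (x₂ ⬝ᵥ x₂)) +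
        (σ ^ 2 + R ^ 2) * (B Q * (x₁ ⬝ᵥ x₁))) :=
        mul_le_mul_of_nonneg_left (add_le_add hb₁ hb₂) (sq_nonneg ν)
    _ = _ := by ring

end OneSample

/-! ### The error of the estimator before thresholding -/

section Tail

lemma dotProduct_mulVec_le_of_trace_exp_lt {n : Type*} [Fintype n] [DecidableEq n]
    {G : Matrix n n ℝ} (hG : G.IsHermitian) {c : ℝ}
    (h : (cfc Real.exp G).trace < Real.exp c) (w : n → ℝ) : w ⬝ᵥ (G *ᵥ w) ≤ c * (w ⬝ᵥ w) := by
  have hG' : IsSelfAdjoint G := hG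
  have hP : (c • (1 : Matrix n n ℝ) - G).PosSemidef := by
    have := posSemidef_cfc_sub_cfc hG (f := fun x => x) (g := fun _ => c) fun x hx => by
      have hx' : Real.exp x ∈ spectrum ℝ (cfc Real.exp G) := by
        rw [cfc_map_spectrum Real.exp G]
        exact ⟨x, hx, rfl⟩
      exact (Real.exp_lt_exp.1
        ((le_trace_of_mem_spectrum (posDef_cfc_exp G hG).posSemidef hx').trans_lt h)).le
    rwa [cfc_id' ℝ G, cfc_const (R := ℝ) c G, Algebra.algebraMap_eq_smul_one] at this
  have := hP.dotProduct_mulVec_nonneg w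
  rw [star_trivial, sub_mulVec, smul_mulVec, one_mulVec, dotProduct_sub, dotProduct_smul,
    smul_eq_mul] at this
  linarith

lemma opNorm_smul {d₁ d₂ : ℕ} (c : ℝ) (A : Matrix (Fin d₁) (Fin d₂) ℝ) :
    opNorm (c • A) = |c| * opNorm A := by
  rw [opNorm, opNorm, map_smul, map_smul, norm_smul, Real.norm_eq_abs]

lemma trace_exp_smul_one {n : Type*} [Fintype n] [DecidableEq n] (c : ℝ) :
    (cfc Real.exp (c • (1 : Matrix n n ℝ))).trace = Fintype.card n * Real.exp c := by
  have h := trace_exp_add_smul_one (n := n) isHermitian_zero c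
  rw [zero_add] at h
  rw [h, cfc_apply_zero, Real.exp_zero, map_one, trace_one, mul_comm]

variable {d₁ d₂ n₀ : ℕ}

/-- The scaled dilation of the one-sample estimate as a function of the design point and the noise
in the observation. -/
def sampleDilation (Q : Matrix (Fin d₂ × Fin d₁) (Fin d₂ × Fin d₁) ℝ)
    (Θ Θ₀ : Matrix (Fin d₁) (Fin d₂) ℝ) (ν : ℝ) (p : Matrix (Fin d₁) (Fin d₂) ℝ × ℝ) :
    Matrix (Fin d₁ ⊕ Fin d₂) (Fin d₁ ⊕ Fin d₂) ℝ :=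
  ν • dilation (oneSample Q Θ₀ p.1 (ip Θ p.1 + p.2))

lemma measurable_sampleDilation (Q : Matrix (Fin d₂ × Fin d₁) (Fin d₂ × Fin d₁) ℝ)
    (Θ Θ₀ : Matrix (Fin d₁) (Fin d₂) ℝ) (ν : ℝ) :
    Measurable (sampleDilation Q Θ Θ₀ ν) := by
  have hip : ∀ T : Matrix (Fin d₁) (Fin d₂) ℝ,
      Measurable fun p : Matrix (Fin d₁) (Fin d₂) ℝ × ℝ => ip T p.1 := fun T => by
    simp only [ip_eq_dotProduct]
    exact (measurable_dotProduct_vec (vec T)).comp measurable_fst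
  have hone : ∀ k i, Measurable fun p : Matrix (Fin d₁) (Fin d₂) ℝ × ℝ =>
      oneSample Q Θ₀ p.1 (ip Θ p.1 + p.2) k i := fun k i => by
    refine (((hip Θ).add measurable_snd).sub (hip Θ₀)).mul ?_
    exact (measurable_dotProduct_vec fun q => Q⁻¹ (i, k) q).comp measurable_fst
  refine measurable_matrix_of fun p q => ?_
  simp only [sampleDilation, Matrix.smul_apply, smul_eq_mul]
  refine Measurable.const_mul ?_ ν
  rcases p with k | i <;> rcases q with l | j
  · simp [dilation]
  · simpa [dilation] using hone k j
  · simpa [dilation] using hone l i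
  · simp [dilation]

/-- The scaled dilation of the error of the estimator before thresholding: the Catoni transforms of
the samples, centred at `n₀ ν` times the dilation of `Θ - Θ₀`. -/
def errorMatrix (Q : Matrix (Fin d₂ × Fin d₁) (Fin d₂ × Fin d₁) ℝ)
    (Θ Θ₀ : Matrix (Fin d₁) (Fin d₂) ℝ) (ν : ℝ)
    (x : Fin n₀ → Matrix (Fin d₁) (Fin d₂) ℝ) (y : Fin n₀ → ℝ) :
    Matrix (Fin d₁ ⊕ Fin d₂) (Fin d₁ ⊕ Fin d₂) ℝ :=
  -((n₀ : ℝ) • ν • dilation (Θ - Θ₀)) + ∑ i, cfc catoni (ν • dilation (oneSample Q Θ₀ (x i) (y i)))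

lemma isHermitian_errorMatrix (Q : Matrix (Fin d₂ × Fin d₁) (Fin d₂ × Fin d₁) ℝ)
    (Θ Θ₀ : Matrix (Fin d₁) (Fin d₂) ℝ) (ν : ℝ)
    (x : Fin n₀ → Matrix (Fin d₁) (Fin d₂) ℝ) (y : Fin n₀ → ℝ) :
    (errorMatrix Q Θ Θ₀ ν x y).IsHermitian := by
  refine IsHermitian.add (IsHermitian.neg (IsSelfAdjoint.smul (IsSelfAdjoint.all (n₀ : ℝ))
    (IsSelfAdjoint.smul (IsSelfAdjoint.all ν) (isHermitian_dilation _)))) ?_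
  rw [IsHermitian, conjTranspose_sum]
  exact Finset.sum_congr rfl fun i _ => isHermitian_cfc _ _

lemma reflection_mul_errorMatrix (Q : Matrix (Fin d₂ × Fin d₁) (Fin d₂ × Fin d₁) ℝ)
    (Θ Θ₀ : Matrix (Fin d₁) (Fin d₂) ℝ) (ν : ℝ)
    (x : Fin n₀ → Matrix (Fin d₁) (Fin d₂) ℝ) (y : Fin n₀ → ℝ) :
    reflection d₁ d₂ * errorMatrix Q Θ Θ₀ ν x y * reflection d₁ d₂ =
      -errorMatrix Q Θ Θ₀ ν x y := by
  simp only [errorMatrix, Matrix.mul_add, Matrix.add_mul, Matrix.mul_neg, Matrix.neg_mul,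
    Matrix.mul_smul, Matrix.smul_mul, Matrix.mul_sum, Matrix.sum_mul, reflection_mul_dilation,
    cfc_catoni_dilation, smul_neg, neg_add, Finset.sum_neg_distrib]

lemma firstEstimate_sub_eq (Q : Matrix (Fin d₂ × Fin d₁) (Fin d₂ × Fin d₁) ℝ)
    (Θ Θ₀ : Matrix (Fin d₁) (Fin d₂) ℝ) {ν : ℝ} (hnν : (n₀ : ℝ) * ν ≠ 0)
    (x : Fin n₀ → Matrix (Fin d₁) (Fin d₂) ℝ) (y : Fin n₀ → ℝ) :
    firstEstimate Q Θ₀ ν x y - Θ = (1 / (n₀ * ν)) • (errorMatrix Q Θ Θ₀ ν x y).toBlocks₁₂ := by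
  have h1 : (errorMatrix Q Θ Θ₀ ν x y).toBlocks₁₂ = -((n₀ : ℝ) • ν • (Θ - Θ₀)) +
      (∑ i, cfc catoni (ν • dilation (oneSample Q Θ₀ (x i) (y i)))).toBlocks₁₂ := by
    ext k i
    simp [errorMatrix, dilation, toBlocks₁₂]
  rw [h1, smul_add, smul_neg, smul_smul, smul_smul, mul_assoc (1 / _), firstEstimate,
    one_div_mul_cancel hnν, one_smul]
  abel

lemma opNorm_firstEstimate_sub_le (Q : Matrix (Fin d₂ × Fin d₁) (Fin d₂ × Fin d₁) ℝ)
    (Θ Θ₀ : Matrix (Fin d₁) (Fin d₂) ℝ) {ν c : ℝ} (hnν : 0 < (n₀ : ℝ) * ν) (hc : 0 < c)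
    (x : Fin n₀ → Matrix (Fin d₁) (Fin d₂) ℝ) (y : Fin n₀ → ℝ)
    (h : (cfc Real.exp (errorMatrix Q Θ Θ₀ ν x y)).trace < Real.exp c) :
    opNorm (firstEstimate Q Θ₀ ν x y - Θ) ≤ c / (n₀ * ν) := by
  have hG := isHermitian_errorMatrix Q Θ Θ₀ ν x y
  have hop := opNorm_toBlocks₁₂_le hG (reflection_mul_errorMatrix Q Θ Θ₀ ν x y) hc
    (dotProduct_mulVec_le_of_trace_exp_lt hG h)
  rw [firstEstimate_sub_eq Q Θ Θ₀ hnν.ne', opNorm_smul, abs_of_pos (by positivity),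
    one_div_mul_eq_div]
  exact div_le_div_of_nonneg_right hop hnν.le

/-- Tail bound for the estimator before thresholding, by the Laplace transform method, with a free
scale `ν`. -/
lemma measure_lt_opNorm_firstEstimate_sub_le
    {π : Measure (Matrix (Fin d₁) (Fin d₂) ℝ)}
    (hπ₂ : ∀ k i, MemLp (fun A : Matrix (Fin d₁) (Fin d₂) ℝ => A k i) 2 π)
    (hQ : IsUnit (covMatrix π).det) (Θ Θ₀ : Matrix (Fin d₁) (Fin d₂) ℝ) {σ R₀ : ℝ}
    (hR₀ : ∀ᵐ A ∂π, |ip (Θ₀ - Θ) A| ≤ R₀)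
    {Ω : Type*} [MeasurableSpace Ω] {μ : Measure Ω} [IsProbabilityMeasure μ]
    {X : Fin n₀ → Ω → Matrix (Fin d₁) (Fin d₂) ℝ} {η Y : Fin n₀ → Ω → ℝ}
    (hX : ∀ i, Measurable (X i)) (hη : ∀ i, Measurable (η i))
    (hY : ∀ i ω, Y i ω = ip Θ (X i ω) + η i ω)
    (hindep : iIndepFun (fun i ω => (X i ω, η i ω)) μ)
    (hlaw : ∀ i, μ.map (X i) = π)
    (hη₂ : ∀ i, MemLp (η i) 2 μ)
    (hη_mean : ∀ i, μ[η i | MeasurableSpace.comap (X i) inferInstance] =ᵐ[μ] 0)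
    (hη_var : ∀ i, μ[fun ω => η i ω ^ 2 | MeasurableSpace.comap (X i) inferInstance]
      ≤ᵐ[μ] fun _ => σ ^ 2)
    {ν c : ℝ} (hν : 0 < ν) (hn₀ : 0 < n₀) (hc : 0 < c) :
    μ {ω | c / (n₀ * ν) < opNorm (firstEstimate (covMatrix π) Θ₀ ν
        (fun i => X i ω) (fun i => Y i ω) - Θ)} ≤
      ENNReal.ofReal ((d₁ + d₂) *
        Real.exp (n₀ * (ν ^ 2 * ((σ ^ 2 + R₀ ^ 2) * B (covMatrix π)) / 2) - c)) := by
  set v : ℝ := (σ ^ 2 + R₀ ^ 2) * B (covMatrix π) with hv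
  have hnν : (0 : ℝ) < n₀ * ν := by positivity
  have hg := measurable_sampleDilation (covMatrix π) Θ Θ₀ ν
  obtain ⟨Z, hZ⟩ : ∃ Z : Fin n₀ → Ω → Matrix (Fin d₁ ⊕ Fin d₂) (Fin d₁ ⊕ Fin d₂) ℝ,
      ∀ i, Z i = sampleDilation (covMatrix π) Θ Θ₀ ν ∘ fun ω => (X i ω, η i ω) :=
    ⟨_, fun _ => rfl⟩
  have hZ' : ∀ i ω, Z i ω =
      ν • dilation (oneSample (covMatrix π) Θ₀ (X i ω) (ip Θ (X i ω) + η i ω)) := fun i ω => by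
    rw [hZ, Function.comp_apply, sampleDilation]
  have hZm : ∀ i, Measurable (Z i) := fun i => by
    rw [hZ]
    exact hg.comp ((hX i).prodMk (hη i))
  have hZh : ∀ i ω, (Z i ω).IsHermitian := fun i ω => by
    rw [hZ']
    exact IsSelfAdjoint.smul (IsSelfAdjoint.all ν) (isHermitian_dilation _)
  have hLm : ∀ i, Measurable fun ω => cfc catoni (Z i ω) := fun i =>
    (measurable_cfc continuous_catoni).comp (hZm i)
  have hLind : iIndepFun (fun i ω => cfc catoni (Z i ω)) μ := by
    have h := hindep.comp (fun _ p => cfc catoni (sampleDilation (covMatrix π) Θ Θ₀ ν p))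
      fun _ => (measurable_cfc continuous_catoni).comp hg
    simp only [hZ]
    exact h
  have hSh : (ν • dilation (Θ - Θ₀)).IsHermitian :=
    IsSelfAdjoint.smul (IsSelfAdjoint.all ν) (isHermitian_dilation _)
  have herr : ∀ ω, errorMatrix (covMatrix π) Θ Θ₀ ν (fun i => X i ω) (fun i => Y i ω) =
      -((n₀ : ℝ) • ν • dilation (Θ - Θ₀)) + ∑ i, cfc catoni (Z i ω) := fun ω => by
    simp only [errorMatrix, hY, hZ']
  have hGm : Measurable fun ω => ENNReal.ofReal (cfc Real.exp
      (-((n₀ : ℝ) • ν • dilation (Θ - Θ₀)) + ∑ i, cfc catoni (Z i ω))).trace :=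
    (measurable_trace_exp.comp
      ((Finset.measurable_fun_sum Finset.univ fun i _ => hLm i).const_add _)).ennreal_ofReal
  have hmgf : ∫⁻ ω, ENNReal.ofReal (cfc Real.exp
      (-((n₀ : ℝ) • ν • dilation (Θ - Θ₀)) + ∑ i, cfc catoni (Z i ω))).trace ∂μ ≤
      ENNReal.ofReal ((d₁ + d₂) * Real.exp (n₀ * (ν ^ 2 * v / 2))) := by
    refine (lintegral_trace_exp_sum_le hLm (fun i ω => isHermitian_cfc _ _) hLind
      (hSh.add (isHermitian_smul_one (ν ^ 2 * v / 2))) (fun i H hH => ?_) Finset.univ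
      (-((n₀ : ℝ) • ν • dilation (Θ - Θ₀)))
      (IsHermitian.neg (IsSelfAdjoint.smul (IsSelfAdjoint.all (n₀ : ℝ)) hSh))).trans_eq ?_
    · have hR : ∀ᵐ ω ∂μ, |ip (Θ₀ - Θ) (X i ω)| ≤ R₀ := by
        rw [← hlaw i] at hR₀
        exact ae_of_ae_map (hX i).aemeasurable hR₀
      obtain ⟨m1, m2, m3, m4⟩ := moments_dilation hπ₂ hQ (hX i) (hη i) (hlaw i) (hη₂ i)
        (hη_mean i) (hη_var i) Θ Θ₀ hR ν (hZ' i)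
      exact lintegral_trace_exp_catoni_le hH (hZm i) (hZh i) m1 m2 hSh m3 m4
    · rw [Finset.card_univ, Fintype.card_fin, smul_add, neg_add_cancel_left, smul_smul,
        trace_exp_smul_one, Fintype.card_sum, Fintype.card_fin, Fintype.card_fin, Nat.cast_add]
  refine (measure_mono (t := {ω | ENNReal.ofReal (Real.exp c) ≤ ENNReal.ofReal (cfc Real.exp
      (-((n₀ : ℝ) • ν • dilation (Θ - Θ₀)) + ∑ i, cfc catoni (Z i ω))).trace}) ?_).trans ?_
  · intro ω hω
    by_contra hlt
    refine (not_le.2 hω) (opNorm_firstEstimate_sub_le (covMatrix π) Θ Θ₀ hnν hc _ _ ?_)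
    rw [herr]
    by_contra hge
    exact hlt (ENNReal.ofReal_le_ofReal (not_lt.1 hge))
  · have hexp : ENNReal.ofReal (Real.exp c) ≠ 0 := by simpa using Real.exp_pos c
    refine (meas_ge_le_lintegral_div hGm.aemeasurable hexp ENNReal.ofReal_ne_top).trans ?_
    refine (ENNReal.div_le_div_right hmgf _).trans_eq ?_
    rw [← ENNReal.ofReal_div_of_pos (Real.exp_pos c), Real.exp_sub, mul_div_assoc]

end Tail
end LowPopArt

end

open LowPopArt in
theorem mainTheorem2 {d₁ d₂ n₀ r : ℕ} (hn₀ : 0 < n₀)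
    (d : ℝ) (hd : ((max d₁ d₂ : ℕ) : ℝ) ≤ d)
    (δ : ℝ) (hδ₀ : 0 < δ) (hδ₁ : δ < 1)
    (σ R₀ : ℝ) (hσ : 0 ≤ σ) (hσR : 0 < σ ^ 2 + R₀ ^ 2)
    -- the arm set, the sampling distribution on it, the unknown matrix and the pilot estimator
    (𝒜 : Set (Matrix (Fin d₁) (Fin d₂) ℝ))
    (π : Measure (Matrix (Fin d₁) (Fin d₂) ℝ)) [IsProbabilityMeasure π]
    (hπ𝒜 : ∀ᵐ A ∂π, A ∈ 𝒜)
    (hπ₂ : ∀ k i, MemLp (fun A : Matrix (Fin d₁) (Fin d₂) ℝ => A k i) 2 π)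
    (hQ : IsUnit (LowPopArt.covMatrix π).det)
    (Θ Θ₀ : Matrix (Fin d₁) (Fin d₂) ℝ) (hr : Θ.rank = r)
    (hR₀ : ∀ A ∈ 𝒜, |LowPopArt.ip (Θ₀ - Θ) A| ≤ R₀)
    -- the samples
    {Ω : Type*} [MeasurableSpace Ω] (μ : Measure Ω) [IsProbabilityMeasure μ]
    (X : Fin n₀ → Ω → Matrix (Fin d₁) (Fin d₂) ℝ) (η Y : Fin n₀ → Ω → ℝ)
    (hX : ∀ i, Measurable (X i)) (hη : ∀ i, Measurable (η i))
    (hY : ∀ i ω, Y i ω = LowPopArt.ip Θ (X i ω) + η i ω)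
    (hindep : iIndepFun (fun i ω => (X i ω, η i ω)) μ)
    (hlaw : ∀ i, μ.map (X i) = π)
    (hη₂ : ∀ i, MemLp (η i) 2 μ)
    (hη_mean : ∀ i, μ[η i | MeasurableSpace.comap (X i) inferInstance] =ᵐ[μ] 0)
    (hη_var : ∀ i, μ[fun ω => η i ω ^ 2 | MeasurableSpace.comap (X i) inferInstance]
      ≤ᵐ[μ] fun _ => σ ^ 2) :
    1 - δ ≤ μ.real {ω |
      (LowPopArt.lowPopArt (LowPopArt.covMatrix π) Θ₀ d σ R₀ δ
        (fun i => X i ω) (fun i => Y i ω)).rank ≤ r ∧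
      LowPopArt.opNorm (LowPopArt.lowPopArt (LowPopArt.covMatrix π) Θ₀ d σ R₀ δ
          (fun i => X i ω) (fun i => Y i ω) - Θ)
        ≤ 2 * LowPopArt.threshold (LowPopArt.covMatrix π) d σ R₀ δ n₀} := by
  -- Subadditivity suffices here, so the event need not be measurable.
  have hbad : ∀ {s : Set Ω}, μ sᶜ ≤ ENNReal.ofReal δ → 1 - δ ≤ μ.real s := by
    intro s hs
    have h1 : (1 : ENNReal) ≤ μ s + μ sᶜ := by
      rw [← measure_univ (μ := μ), ← Set.union_compl_self s]
      exact measure_union_le _ _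
    have h2 : (1 : ENNReal) ≤ ENNReal.ofReal (μ.real s + δ) := by
      rw [ENNReal.ofReal_add measureReal_nonneg hδ₀.le, ofReal_measureReal]
      exact h1.trans (by gcongr)
    rw [ENNReal.one_le_ofReal] at h2
    linarith
  -- For `d₁ = 0` or `d₂ = 0` there is only one matrix, and `B Q` need not be positive.
  rcases Nat.eq_zero_or_pos d₁ with rfl | h₁
  · refine hbad ?_
    rw [Set.compl_empty_iff.2 (Set.eq_univ_of_forall fun ω => ?_), measure_empty]
    · exact zero_le
    rw [Set.mem_ofPred_eq, Subsingleton.elim (lowPopArt _ _ _ _ _ _ _ _) Θ]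
    refine ⟨hr.le, ?_⟩
    rw [sub_self, opNorm, map_zero, map_zero, norm_zero]
    unfold threshold
    positivity
  rcases Nat.eq_zero_or_pos d₂ with rfl | h₂
  · refine hbad ?_
    rw [Set.compl_empty_iff.2 (Set.eq_univ_of_forall fun ω => ?_), measure_empty]
    · exact zero_le
    rw [Set.mem_ofPred_eq, Subsingleton.elim (lowPopArt _ _ _ _ _ _ _ _) Θ]
    refine ⟨hr.le, ?_⟩
    rw [sub_self, opNorm, map_zero, map_zero, norm_zero]
    unfold threshold
    positivity
  set Q := covMatrix π with hQdef
  have hB : 0 < B Q := B_pos (covMatrix_posDef hπ₂ hQ) h₁ h₂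
  have hd₁ : (d₁ : ℝ) ≤ d := le_trans (by exact_mod_cast le_max_left _ _) hd
  have hd₂ : (d₂ : ℝ) ≤ d := le_trans (by exact_mod_cast le_max_right _ _) hd
  have hd_one : 1 ≤ d := le_trans (by exact_mod_cast h₁) hd₁
  have hn : (0 : ℝ) < n₀ := by exact_mod_cast hn₀
  -- The scale satisfies `n₀ ν² v = L`, and the threshold is `2 L / (n₀ ν)`.
  set L := Real.log (2 * d / δ) with hL
  have hratio : 1 < 2 * d / δ := by
    rw [one_lt_div hδ₀]
    linarith
  have hLpos : 0 < L := Real.log_pos hratio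
  set v := (σ ^ 2 + R₀ ^ 2) * B Q with hv
  have hvpos : 0 < v := mul_pos hσR hB
  set ν := scale Q d σ R₀ δ n₀ with hν
  set τ := threshold Q d σ R₀ δ n₀ with hτ
  have hνpos : 0 < ν := Real.sqrt_pos.2 (by positivity)
  have hν_sq : n₀ * (ν ^ 2 * v) = L := by
    rw [hν, scale, ← hv, ← hL, Real.sq_sqrt (by positivity)]
    field_simp
  have hτν : τ = 2 * L / (n₀ * ν) := by
    have hsqrt : Real.sqrt (v * L / n₀) = ν * v := by
      rw [Real.sqrt_eq_iff_mul_self_eq (by positivity) (by positivity)]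
      field_simp
      rw [← hν_sq]
      ring
    rw [hτ, threshold, hsqrt, eq_div_iff (by positivity), ← hν_sq]
    ring
  have hτ0 : 0 ≤ τ := by rw [hτν]; positivity
  refine hbad ((measure_mono fun ω hω => ?_).trans
    ((measure_lt_opNorm_firstEstimate_sub_le hπ₂ hQ Θ Θ₀ (hπ𝒜.mono fun A hA => hR₀ A hA) hX hη hY
      hindep hlaw hη₂ hη_mean hη_var hνpos hn₀ (c := 2 * L) (by positivity)).trans
      (ENNReal.ofReal_le_ofReal ?_)))
  · by_contra hle
    rw [Set.mem_ofPred_eq, not_lt, ← hτν] at hle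
    refine hω ⟨?_, opNorm_hardThreshold_sub_le_two_mul hτ0 hle⟩
    exact hr ▸ rank_hardThreshold_le hτ0 hle
  · -- The exponent is `L / 2 - 2 L ≤ - L`, and `exp (- L) = δ / (2 d)`.
    calc ((d₁ : ℝ) + d₂) * Real.exp (n₀ * (ν ^ 2 * v / 2) - 2 * L)
        ≤ (2 * d) * Real.exp (-L) := by
          have : n₀ * (ν ^ 2 * v / 2) - 2 * L ≤ -L := by
            have : n₀ * (ν ^ 2 * v / 2) = L / 2 := by rw [← hν_sq]; ring
            linarith
          gcongr
          linarith
      _ = δ := by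
          rw [Real.exp_neg, hL, Real.exp_log (by linarith)]
          field_simp
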